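/- **Setting.** Let $(W,H,\mu_W)$ be an abstract Wiener space: $W$ is a separable real Banach space, $H$ a separable real Hilbert space continuously and densely embedded in $W$, so that $W^*\subset H\subset W$, and $\mu_W$ is the Borel probability measure on $W$ under which every $\varphi\in W^*$ has law $N(0,|\varphi|_H^2)$. Let $x$ be an $H$-valued random variable with values a.s. in $W^*$ and with $E\exp(\alpha (x,h)_H)<\infty$ for all $\alpha\in\mathbb R$, $h\in W^*$. Let $w$ be a $W$-valued random variable with law $\mu_W$, independent of $x$. For $\rho\in\mathbb R$ put $y=\rho x+w$, let $\mu_Y$ be the law of $y$, $\ell=d\mu_Y/d\mu_W$, and let $\mu_{X|Y}(\cdot\,;v)$, $v\in W$, be the regular conditional distribution of $x$ given $y$. For a function $f$ on $H$ write $E(f(x)|Y)$ for the function $v\mapsto\int f\,d\mu_{X|Y}(\cdot\,;v)$ on $W$. **Gradients.** For real random variables $F,G$ on $(W,\mu_W)$ and $h\in H$, $\nabla_hF=G$ means that $F$ has a version which is locally absolutely continuous along every line with direction $h$, and that $\frac1t\,(F(v+th)-F(v))\to G(v)$ in $\mu_W$-probability as $t\to0$. The ($H$-valued) Malliavin gradient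 $\nabla F$ is the $H$-valued random variable with $(\nabla F,h)_H=\nabla_hF$ for all $h\in H$; for $F,|\nabla F|_H\in L^2(\mu_W)$ this is the gradient obtained by closure from smooth cylindrical functions. Moreover $(\nabla^nF,h_1\otimes\dots\otimes h_n)=\nabla_{h_n}\cdots\nabla_{h_1}F$, where $\nabla^nF$ is called $H^{\otimes n}$-valued if, a.s., this is given by a Hilbert–Schmidt $n$-linear form on $H$, and $\nabla^2_{h_1,h_2}F=\nabla_{h_1}\nabla_{h_2}F$. The trace of a bilinear form $A$ on $H$ exists if $\sum_k A(e_k,e_k)$ converges absolutely, to the same value, for every complete orthonormal basis $(e_k)$. **Proposition 4.1.** One has $\mu_Y\ll\mu_W$ and $\ell>0$ $\mu_W$-a.s.; if $\rho\neq0$, then for all $n$ and $h_1,\dots,h_n\in H$ the product $\prod_i(h_i,\cdot)_H$ is $\mu_{X|Y}(\cdot\,;v)$-integrable for $\mu_W$-a.e. $v$. All the following derivatives exist and all identities hold $\mu_W$-a.s. (a) For all $h\in H$: $\nabla_h\ell=\rho\,\ell\,E((x,h)_H|Y)$ and $\nabla_h\log\ell=\rho\,E((x,h)_H|Y)$. If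 $E|x|_H<\infty$, then $E(x|Y)$ exists as an $H$-valued (Bochner) integral, $(E(x|Y),h)_H=E((x,h)_H|Y)$ for all $h\in H$, and $$\nabla\ell=\rho\,\ell\,E(x|Y),\qquad \nabla\log\ell=\rho\,E(x|Y),$$ so that $E(x|Y)=\frac1\rho\nabla\log\ell$ if $\rho\ne0$. (b) For all $n\ge0$ and $h_1,\dots,h_n\in H$: $$(\nabla^n\ell,h_1\otimes\dots\otimes h_n)=\rho^n\,\ell\,E\Big(\prod_{i=1}^n(h_i,x)_H\Big|Y\Big).$$ If $E|x|_H^n<\infty$, then $E(|x|_H^n|Y)<\infty$ a.s., $\nabla^n\ell$ exists as an $H^{\otimes n}$-valued random variable, and this identity holds a.s. simultaneously for all $h_1,\dots,h_n\in H$. (c) If $E|x|_H^2<\infty$, then $\operatorname{trace}\nabla^2\ell$ exists and equals $\rho^2\,\ell\,E(|x|_H^2|Y)$. For all $h,h_1,h_2\in H$: $$\nabla^2_{h_1,h_2}\ell=\rho^2\,\ell\,E\big((h_1,x)_H(h_2,x)_H\big|Y\big),\qquad \nabla^2_{h,h}\log\ell=\rho^2\Big(E\big((x,h)_H^2\big|Y\big)-E\big((x,h)_H\big|Y\big)^2\Big).$$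 (d) For all $n\ge1$ and $h_1,\dots,h_n\in H$: $$\nabla_{h_n}E\Big(\prod_{i=1}^{n-1}(h_i,x)_H\Big|Y\Big)=\rho\Big(E\Big(\prod_{i=1}^{n}(h_i,x)_H\Big|Y\Big)-E((h_n,x)_H|Y)\,E\Big(\prod_{i=1}^{n-1}(h_i,x)_H\Big|Y\Big)\Big),$$ that is, if $\rho\neq0$, $$E\Big(\prod_{i=1}^{n}(h_i,x)_H\Big|Y\Big)=E((h_n,x)_H|Y)\,E\Big(\prod_{i=1}^{n-1}(h_i,x)_H\Big|Y\Big)+\frac1\rho\,\nabla_{h_n}E\Big(\prod_{i=1}^{n-1}(h_i,x)_H\Big|Y\Big).$$ -/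

import Mathlib

open MeasureTheory ProbabilityTheory Filter Topology
open scoped RealInnerProductSpace

namespace GaussianChannel

noncomputable section

/-- The canonical map `W* → H` of an abstract Wiener space with embedding `i : H → W`:
`dualEmb i φ` is the element of `H` with `⟪dualEmb i φ, h⟫ = φ (i h)` for all `h : H`. -/
def dualEmb {W H : Type*} [NormedAddCommGroup W] [NormedSpace ℝ W]
    [NormedAddCommGroup H] [InnerProductSpace ℝ H] [CompleteSpace H]
    (i : H →L[ℝ] W) (φ : StrongDual ℝ W) : H :=
  (InnerProductSpace.toDual ℝ H).symm (φ.comp i)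

/-- `(W, H, μ)` is an abstract Wiener space: the Hilbert space `H` is continuously and densely
embedded in `W` through `i`, and under `μ` every `φ ∈ W*` is a centred Gaussian random variable
whose variance is the squared `H`-norm of `φ`. -/
structure IsAbstractWienerSpace {W H : Type*} [NormedAddCommGroup W] [NormedSpace ℝ W]
    [MeasurableSpace W] [NormedAddCommGroup H] [InnerProductSpace ℝ H] [CompleteSpace H]
    (i : H →L[ℝ] W) (μ : Measure W) : Prop where
  injective : Function.Injective i
  denseRange : DenseRange i
  map_dual : ∀ φ : StrongDual ℝ W, μ.map φ = gaussianReal 0 (‖dualEmb i φ‖₊ ^ 2)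

/-- `∇_h F = G`: the derivative of the random variable `F` on the Wiener space in the direction
`h ∈ H`, in the sense of Kusuoka and Stroock.
* Ray absolute continuity: some version of `F` is locally absolutely continuous on every line
  with direction `h`.
* Stochastic Gateaux differentiability: `(F (w + t h) - F w) / t → G w` in probability as
  `t → 0`.
The notion only depends on the `μ`-classes of `F` and `G`, and `G` is determined by `F` up to
`μ`-null sets. For smooth cylindrical `F` it is the derivative of `ε ↦ F (w + ε h)` at `0`. -/
structure HasDerivAlong {W H : Type*} [NormedAddCommGroup W] [NormedSpace ℝ W]
    [MeasurableSpace W] [NormedAddCommGroup H] [InnerProductSpace ℝ H]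
    (i : H →L[ℝ] W) (μ : Measure W) (h : H) (F G : W → ℝ) : Prop where
  aemeasurable : AEMeasurable F μ
  aemeasurable_deriv : AEMeasurable G μ
  ray_absolutelyContinuous : ∃ F' : W → ℝ, F' =ᵐ[μ] F ∧
    ∀ w : W, ∀ a b : ℝ, AbsolutelyContinuousOnInterval (fun t : ℝ => F' (w + t • i h)) a b
  tendsto_quotient :
    TendstoInMeasure μ (fun (t : ℝ) (w : W) => (F (w + t • i h) - F w) / t) (𝓝[≠] 0) G

/-- `∇F = G`: the `H`-valued random variable `G` is the Malliavin gradient of `F`, i.e.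
`⟪G, h⟫ = ∇_h F` for all `h ∈ H`. For `F` and `|G|_H` in `L²(μ)` this is equivalent to the
definition of the gradient by closure from the smooth cylindrical random variables. -/
structure HasGradient {W H : Type*} [NormedAddCommGroup W] [NormedSpace ℝ W]
    [MeasurableSpace W] [NormedAddCommGroup H] [InnerProductSpace ℝ H]
    (i : H →L[ℝ] W) (μ : Measure W) (F : W → ℝ) (G : W → H) : Prop where
  aestronglyMeasurable : AEStronglyMeasurable G μ
  derivAlong : ∀ h : H, HasDerivAlong i μ h F (fun w => ⟪G w, h⟫)

/-- `(∇ⁿF, h₁ ⊗ ⋯ ⊗ hₙ) = G`, where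
`(∇ⁿ⁺¹F, h₁ ⊗ ⋯ ⊗ hₙ₊₁) = ∇_{hₙ₊₁} (∇ⁿF, h₁ ⊗ ⋯ ⊗ hₙ)`. -/
def HasIteratedDerivAlong {W H : Type*} [NormedAddCommGroup W] [NormedSpace ℝ W]
    [MeasurableSpace W] [NormedAddCommGroup H] [InnerProductSpace ℝ H]
    (i : H →L[ℝ] W) (μ : Measure W) (F : W → ℝ) :
    (n : ℕ) → (Fin n → H) → (W → ℝ) → Prop
  | 0, _, G => G =ᵐ[μ] F
  | n + 1, h, G => ∃ G' : W → ℝ, HasIteratedDerivAlong i μ F n (Fin.init h) G' ∧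
      HasDerivAlong i μ (h (Fin.last n)) G' G

/-- The continuous `n`-linear form `T` on `H` is Hilbert-Schmidt, i.e. it is `(τ, h₁ ⊗ ⋯ ⊗ hₙ)`
for an element `τ` of the Hilbert space `H^{⊗n}`. -/
def IsHilbertSchmidt {H : Type*} [NormedAddCommGroup H] [InnerProductSpace ℝ H] {n : ℕ}
    (T : ContinuousMultilinearMap ℝ (fun _ : Fin n => H) ℝ) : Prop :=
  ∀ (ι : Type) (b : HilbertBasis ι ℝ H), Summable fun k : Fin n → ι => (T fun j => b (k j)) ^ 2

/-- `∇ⁿF = T`, where `T` takes values in `H^{⊗n}`, realized as the space of Hilbert-Schmidt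
`n`-linear forms on `H`. -/
structure HasIteratedGradient {W H : Type*} [NormedAddCommGroup W] [NormedSpace ℝ W]
    [MeasurableSpace W] [NormedAddCommGroup H] [InnerProductSpace ℝ H]
    (i : H →L[ℝ] W) (μ : Measure W) (n : ℕ) (F : W → ℝ)
    (T : W → ContinuousMultilinearMap ℝ (fun _ : Fin n => H) ℝ) : Prop where
  hilbertSchmidt : ∀ᵐ w ∂μ, IsHilbertSchmidt (T w)
  derivAlong : ∀ h : Fin n → H, HasIteratedDerivAlong i μ F n h (fun w => T w h)

/-- The trace of a bilinear form on `H` exists and equals `τ`: for every complete orthonormal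
basis `e` the series `∑ T (e_k, e_k)` converges absolutely to `τ`. -/
def HasTrace {H : Type*} [NormedAddCommGroup H] [InnerProductSpace ℝ H]
    (T : ContinuousMultilinearMap ℝ (fun _ : Fin 2 => H) ℝ) (τ : ℝ) : Prop :=
  ∀ (ι : Type) (b : HilbertBasis ι ℝ H), HasSum (fun k : ι => T ![b k, b k]) τ

/-- The output `y = ρ x + w` of the additive Gaussian channel. -/
def channel {Ω W H : Type*} [NormedAddCommGroup W] [NormedSpace ℝ W]
    [NormedAddCommGroup H] [InnerProductSpace ℝ H]
    (i : H →L[ℝ] W) (ρ : ℝ) (x : Ω → H) (w : Ω → W) : Ω → W :=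
  fun ω => ρ • i (x ω) + w ω

/-- The likelihood ratio `ℓ = dμ_Y / dμ_W`, where `μ_Y` is the law of `y`. -/
def likelihoodRatio {Ω W : Type*} [MeasurableSpace Ω] [MeasurableSpace W]
    (P : Measure Ω) (y : Ω → W) (μ : Measure W) : W → ℝ :=
  fun w => ((P.map y).rnDeriv μ w).toReal

/-- The conditional expectation `E (f(x) | Y)` as a function on `W`: the integral of `f` against
the regular conditional distribution of `x` given `y`. -/
def condMean {Ω W H E : Type*} [MeasurableSpace Ω] [MeasurableSpace W]
    [MeasurableSpace H] [StandardBorelSpace H] [Nonempty H]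
    [NormedAddCommGroup E] [NormedSpace ℝ E]
    (P : Measure Ω) [IsFiniteMeasure P] (x : Ω → H) (y : Ω → W) (f : H → E) : W → E :=
  fun w => ∫ z, f z ∂(condDistrib x y P w)

end

end GaussianChannel

/-!
Conditionally on the signal `z`, which is represented by a functional `Φ z ∈ W*`, the output has
the law of `v ↦ v + ρ z` under `μ`. By the Cameron-Martin formula its density is the likelihood
`L(v, z) = exp (ρ Φ z v - ρ² |z|² / 2)`. Hence `ℓ(v) = ∫ L(v, z) ν(dz)`, where `ν` is the law of the
signal, and by Bayes' formula the conditional law of the signal is `L(v, z) ν(dz) / ℓ(v)`. Thus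
everything is expressed through the unnormalized moments `A(h₁, …, hₙ) = ∫ ∏ (h_k, z) L(v, z) ν(dz)`
(`likMoment`): `ℓ = A()` and `E(∏ (h_k, x) | Y) = A(h₁, …, hₙ) / A()`.

A shift of the observation by `t h`, `h ∈ H`, multiplies `L(v, z)` by `exp (t ρ (h, z))`. So along
lines with direction `h` the moments are Laplace transforms, and differentiation under the integral
sign gives `∇_h A(h₁, …, hₙ) = ρ A(h₁, …, hₙ, h)`. The product and quotient rules turn this into all
the directional formulas. What makes the Laplace transforms finite for every `h ∈ H`, and not only
for `h ∈ W*`, is the quasi-invariance of `μ` under shifts by `H`: as `ℓ` is finite almost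
everywhere, so are its translates by the multiples of `h`, and these are the exponential moments of `(h, z)`
(`ae_mem_expDomain`). The set `expDomain` on which the exponential moments of finitely many
directions are finite has full measure and is invariant under shifts in these directions, hence
pointwise differentiability there suffices (`HasDerivAlong.of_hasDerivAt`). For `ρ = 0` all
functions of the observation are constant.

If `E |x|ⁿ` is finite, the `n`-th gradient is `ρⁿ ℓ` times the conditional mean of the tensor power
`x ⊗ ⋯ ⊗ x`, a Bochner integral in the space of `n`-linear forms. It is Hilbert-Schmidt by Bessel's
inequality, and for `n = 2` Parseval's identity computes its trace.
-/

open MeasureTheory ProbabilityTheory Filter Topology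
open scoped RealInnerProductSpace

namespace GaussianChannel

/-! ### Shifts of the Gaussian measure -/

section CameronMartin

variable {W H : Type*} [NormedAddCommGroup W] [NormedSpace ℝ W]
  [NormedAddCommGroup H] [InnerProductSpace ℝ H] [CompleteSpace H] {i : H →L[ℝ] W}

lemma inner_dualEmb (i : H →L[ℝ] W) (φ : StrongDual ℝ W) (h : H) :
    ⟪dualEmb i φ, h⟫ = φ (i h) := by
  simp [dualEmb]

lemma dualEmb_add (i : H →L[ℝ] W) (φ ψ : StrongDual ℝ W) :
    dualEmb i (φ + ψ) = dualEmb i φ + dualEmb i ψ := by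
  simp [dualEmb, ContinuousLinearMap.add_comp]

lemma dualEmb_smul (i : H →L[ℝ] W) (c : ℝ) (φ : StrongDual ℝ W) :
    dualEmb i (c • φ) = c • dualEmb i φ := by
  simp [dualEmb, ContinuousLinearMap.smul_comp]

lemma denseRange_dualEmb (hi : Function.Injective i) : DenseRange (dualEmb i) := by
  let E : Submodule ℝ H :=
    { carrier := Set.range (dualEmb i)
      add_mem' := by
        rintro _ _ ⟨φ, rfl⟩ ⟨ψ, rfl⟩
        exact ⟨φ + ψ, dualEmb_add i φ ψ⟩
      zero_mem' := ⟨0, by simp [dualEmb]⟩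
      smul_mem' := by
        rintro c _ ⟨φ, rfl⟩
        exact ⟨c • φ, dualEmb_smul i c φ⟩ }
  have hE : E.topologicalClosure = ⊤ := by
    rw [Submodule.topologicalClosure_eq_top_iff, Submodule.eq_bot_iff]
    intro h hh
    rw [Submodule.mem_orthogonal] at hh
    have h0 : i h = 0 := by
      refine SeparatingDual.eq_zero_of_forall_dual_eq_zero (R := ℝ) fun φ => ?_
      rw [← inner_dualEmb]
      exact hh _ ⟨φ, rfl⟩
    exact hi (h0.trans (map_zero i).symm)
  have hd := (Submodule.dense_iff_topologicalClosure_eq_top).2 hE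
  exact hd

lemma norm_dualEmb_smul_add_sq (i : H →L[ℝ] W) (φ ψ : StrongDual ℝ W) (t : ℝ) :
    ‖dualEmb i (t • ψ + φ)‖ ^ 2 =
      ‖dualEmb i ψ‖ ^ 2 * t ^ 2 + 2 * t * ψ (i (dualEmb i φ)) + ‖dualEmb i φ‖ ^ 2 := by
  rw [dualEmb_add, dualEmb_smul, norm_add_sq_real, norm_smul, mul_pow, real_inner_smul_left,
    inner_dualEmb, Real.norm_eq_abs, sq_abs]
  ring

/-- The Cameron-Martin density of the shift by `dualEmb i φ`, with respect to the Gaussian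
measure. -/
noncomputable def cmDensity (i : H →L[ℝ] W) (φ : StrongDual ℝ W) (v : W) : ℝ :=
  Real.exp (φ v - ‖dualEmb i φ‖ ^ 2 / 2)

lemma cmDensity_pos (φ : StrongDual ℝ W) (v : W) : 0 < cmDensity i φ v := Real.exp_pos _

lemma continuous_cmDensity (φ : StrongDual ℝ W) : Continuous (cmDensity i φ) := by
  unfold cmDensity; fun_prop

variable [MeasurableSpace W] {μ : Measure W}

lemma IsAbstractWienerSpace.isProbabilityMeasure (hμ : IsAbstractWienerSpace i μ) :
    IsProbabilityMeasure μ := by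
  have h := hμ.map_dual 0
  have : IsProbabilityMeasure (μ.map (0 : StrongDual ℝ W)) := by rw [h]; infer_instance
  exact Measure.isProbabilityMeasure_of_map (0 : StrongDual ℝ W)

lemma IsAbstractWienerSpace.mgf_dual (hμ : IsAbstractWienerSpace i μ) (φ : StrongDual ℝ W)
    (t : ℝ) : mgf φ μ t = Real.exp (‖dualEmb i φ‖ ^ 2 * t ^ 2 / 2) := by
  rw [mgf_gaussianReal (hμ.map_dual φ)]; simp

lemma IsAbstractWienerSpace.integral_exp (hμ : IsAbstractWienerSpace i μ) (φ : StrongDual ℝ W) :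
    ∫ v, Real.exp (φ v) ∂μ = Real.exp (‖dualEmb i φ‖ ^ 2 / 2) := by
  simpa [mgf] using hμ.mgf_dual φ 1

lemma IsAbstractWienerSpace.integrable_exp (hμ : IsAbstractWienerSpace i μ)
    (φ : StrongDual ℝ W) : Integrable (fun v => Real.exp (φ v)) μ := by
  refine Integrable.of_integral_ne_zero ?_
  rw [hμ.integral_exp]
  positivity

lemma IsAbstractWienerSpace.integrable_cmDensity (hμ : IsAbstractWienerSpace i μ)
    (φ : StrongDual ℝ W) : Integrable (cmDensity i φ) μ := by
  have := (hμ.integrable_exp φ).div_const (Real.exp (‖dualEmb i φ‖ ^ 2 / 2))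
  simp only [← Real.exp_sub] at this
  exact this

lemma IsAbstractWienerSpace.integral_cmDensity_mul (hμ : IsAbstractWienerSpace i μ)
    (φ ψ : StrongDual ℝ W) :
    ∫ v, cmDensity i φ v * cmDensity i ψ v ∂μ = Real.exp ⟪dualEmb i φ, dualEmb i ψ⟫ := by
  have h : ∀ v, cmDensity i φ v * cmDensity i ψ v =
      Real.exp ((φ + ψ) v) * Real.exp (-(‖dualEmb i φ‖ ^ 2 / 2 + ‖dualEmb i ψ‖ ^ 2 / 2)) := by
    intro v
    rw [cmDensity, cmDensity, ← Real.exp_add, ← Real.exp_add]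
    congr 1
    simp only [_root_.add_apply]
    ring
  simp_rw [h]
  rw [integral_mul_const, hμ.integral_exp, ← Real.exp_add, dualEmb_add, norm_add_sq_real]
  congr 1
  ring

lemma IsAbstractWienerSpace.integrable_cmDensity_mul (hμ : IsAbstractWienerSpace i μ)
    (φ ψ : StrongDual ℝ W) : Integrable (fun v => cmDensity i φ v * cmDensity i ψ v) μ := by
  refine Integrable.of_integral_ne_zero ?_
  rw [hμ.integral_cmDensity_mul]
  positivity

lemma IsAbstractWienerSpace.memLp_cmDensity (hμ : IsAbstractWienerSpace i μ)
    (φ : StrongDual ℝ W) : MemLp (cmDensity i φ) 2 μ := by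
  rw [memLp_two_iff_integrable_sq (hμ.integrable_cmDensity φ).1]
  simpa only [sq] using hμ.integrable_cmDensity_mul φ φ

variable [BorelSpace W] [CompleteSpace W] [SecondCountableTopology W]

/-- **Cameron-Martin formula** for a direction in `W*`. -/
theorem IsAbstractWienerSpace.map_add_dualEmb (hμ : IsAbstractWienerSpace i μ)
    (φ : StrongDual ℝ W) :
    μ.map (fun v => v + i (dualEmb i φ)) =
      μ.withDensity (fun v => ENNReal.ofReal (cmDensity i φ v)) := by
  have := hμ.isProbabilityMeasure
  have : IsFiniteMeasure (μ.withDensity (fun v => ENNReal.ofReal (cmDensity i φ v))) :=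
    isFiniteMeasure_withDensity_ofReal (hμ.integrable_cmDensity φ).2
  have hmeas : Measurable (fun v : W => v + i (dualEmb i φ)) := by fun_prop
  have : IsProbabilityMeasure (μ.map (fun v => v + i (dualEmb i φ))) :=
    Measure.isProbabilityMeasure_map hmeas.aemeasurable
  refine Measure.ext_of_charFunDual (funext fun ψ => ?_)
  have hc : ∀ ν : Measure W, charFunDual ν ψ = complexMGF ψ ν Complex.I := by
    intro ν
    simp [charFunDual_apply, complexMGF, mul_comm]
  -- both one-dimensional marginals have a Laplace transform that is finite everywhere
  have h1 : ∀ t, mgf ψ (μ.map (fun v => v + i (dualEmb i φ))) t =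
      Real.exp (t * ψ (i (dualEmb i φ)) + ‖dualEmb i ψ‖ ^ 2 * t ^ 2 / 2) := by
    intro t
    rw [mgf, integral_map hmeas.aemeasurable (by fun_prop)]
    have h : ∀ v, Real.exp (t * ψ (v + i (dualEmb i φ))) =
        Real.exp (t * ψ v) * Real.exp (t * ψ (i (dualEmb i φ))) := by
      intro v; rw [← Real.exp_add, map_add, mul_add]
    simp_rw [h]
    rw [integral_mul_const]
    change mgf ψ μ t * _ = _
    rw [hμ.mgf_dual, ← Real.exp_add, add_comm]
  have h2 : ∀ t, mgf ψ (μ.withDensity (fun v => ENNReal.ofReal (cmDensity i φ v))) t =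
      Real.exp (t * ψ (i (dualEmb i φ)) + ‖dualEmb i ψ‖ ^ 2 * t ^ 2 / 2) := by
    intro t
    rw [mgf, integral_withDensity_eq_integral_toReal_smul
      (continuous_cmDensity φ).measurable.ennreal_ofReal (by simp)]
    have h : ∀ v, (ENNReal.ofReal (cmDensity i φ v)).toReal • Real.exp (t * ψ v) =
        Real.exp ((t • ψ + φ) v) * Real.exp (-(‖dualEmb i φ‖ ^ 2 / 2)) := by
      intro v
      rw [ENNReal.toReal_ofReal (cmDensity_pos φ v).le, cmDensity, smul_eq_mul, ← Real.exp_add,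
        ← Real.exp_add]
      congr 1
      simp only [_root_.add_apply, _root_.smul_apply, smul_eq_mul]
      ring
    simp_rw [h]
    rw [integral_mul_const, hμ.integral_exp, ← Real.exp_add, norm_dualEmb_smul_add_sq]
    congr 1
    ring
  have hmgf : mgf ψ (μ.map (fun v => v + i (dualEmb i φ))) =
      mgf ψ (μ.withDensity (fun v => ENNReal.ofReal (cmDensity i φ v))) := by
    funext t; rw [h1, h2]
  have hset : integrableExpSet ψ (μ.map (fun v => v + i (dualEmb i φ))) = Set.univ := by
    refine Set.eq_univ_of_forall fun t => ?_
    rw [integrableExpSet, Set.mem_ofPred_eq]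
    refine Integrable.of_integral_ne_zero ?_
    change mgf _ _ _ ≠ 0
    rw [h1]; positivity
  rw [hc, hc]
  refine eqOn_complexMGF_of_mgf hmgf ?_
  simp [hset]

/-- The Gaussian measure is quasi-invariant under shifts by elements of `H`. The densities of the
shifts by elements of `W*` converge in `L²(μ)` when the shifts converge in `H`, and the limit is
a density of the limiting shift. -/
theorem IsAbstractWienerSpace.map_add_absolutelyContinuous (hμ : IsAbstractWienerSpace i μ)
    (h : H) : μ.map (fun v => v + i h) ≪ μ := by
  have := hμ.isProbabilityMeasure
  have hmeas : ∀ z : H, Measurable (fun v : W => v + i z) := fun z => by fun_prop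
  obtain ⟨z, hz, hzh⟩ := mem_closure_iff_seq_limit.1 (denseRange_dualEmb hμ.injective h)
  choose φ hφ using hz
  obtain rfl : (fun n => dualEmb i (φ n)) = z := funext hφ
  clear hφ
  -- `⟪u m, u n⟫ = exp ⟪z_m, z_n⟫` for the densities `u n` of the shifts by `z_n`, so that the
  -- densities form a Cauchy sequence
  let u : ℕ → Lp ℝ 2 μ := fun n => (hμ.memLp_cmDensity (φ n)).toLp _
  have hu0 : ∀ n, 0 ≤ u n := by
    intro n
    rw [← Lp.coeFn_nonneg]
    filter_upwards [(hμ.memLp_cmDensity (φ n)).coeFn_toLp] with v hv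
    rw [hv]
    exact (cmDensity_pos _ _).le
  have hinner : ∀ m n, ⟪u m, u n⟫ = Real.exp ⟪dualEmb i (φ m), dualEmb i (φ n)⟫ := by
    intro m n
    rw [L2.inner_def, ← hμ.integral_cmDensity_mul]
    refine integral_congr_ae ?_
    filter_upwards [(hμ.memLp_cmDensity (φ n)).coeFn_toLp,
      (hμ.memLp_cmDensity (φ m)).coeFn_toLp] with v h1 h2
    rw [h1, h2]
    simp [mul_comm]
  have hcauchy : CauchySeq u := by
    rw [cauchySeq_iff_tendsto_dist_atTop_0]
    have hd : ∀ p : ℕ × ℕ, dist (u p.1) (u p.2) =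
        √(Real.exp ⟪dualEmb i (φ p.1), dualEmb i (φ p.1)⟫
          - 2 * Real.exp ⟪dualEmb i (φ p.1), dualEmb i (φ p.2)⟫
          + Real.exp ⟪dualEmb i (φ p.2), dualEmb i (φ p.2)⟫) := by
      intro p
      rw [← hinner, ← hinner, ← hinner, real_inner_self_eq_norm_sq, real_inner_self_eq_norm_sq,
        ← norm_sub_sq_real, Real.sqrt_sq (norm_nonneg _), dist_eq_norm]
    simp_rw [hd]
    have h1 : Tendsto (fun p : ℕ × ℕ => dualEmb i (φ p.1)) atTop (𝓝 h) := by
      rw [← prod_atTop_atTop_eq]; exact hzh.comp tendsto_fst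
    have h2 : Tendsto (fun p : ℕ × ℕ => dualEmb i (φ p.2)) atTop (𝓝 h) := by
      rw [← prod_atTop_atTop_eq]; exact hzh.comp tendsto_snd
    have h3 := (((h1.inner (𝕜 := ℝ) h1).rexp.sub ((h1.inner (𝕜 := ℝ) h2).rexp.const_mul 2)).add
      (h2.inner (𝕜 := ℝ) h2).rexp).sqrt
    convert h3 using 2
    rw [eq_comm, Real.sqrt_eq_zero']
    linarith
  obtain ⟨D, hD⟩ := cauchySeq_tendsto_of_complete hcauchy
  have hD0 : 0 ≤ D := ge_of_tendsto' hD hu0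
  have hDint : Integrable D μ := (Lp.memLp D).integrable (by norm_num)
  have : IsFiniteMeasure (μ.withDensity (fun v => ENNReal.ofReal (D v))) :=
    isFiniteMeasure_withDensity_ofReal hDint.2
  have : IsProbabilityMeasure (μ.map (fun v => v + i h)) :=
    Measure.isProbabilityMeasure_map (hmeas h).aemeasurable
  suffices μ.map (fun v => v + i h) = μ.withDensity (fun v => ENNReal.ofReal (D v)) by
    rw [this]; exact withDensity_absolutelyContinuous _ _
  refine ext_of_forall_integral_eq_of_IsFiniteMeasure fun f => ?_
  have hfL : MemLp f 2 μ := (MemLp.of_bound f.continuous.aestronglyMeasurable ‖f‖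
    (ae_of_all _ f.norm_coe_le_norm))
  have hf1 : Tendsto (fun n => ∫ v, f (v + i (dualEmb i (φ n))) ∂μ) atTop
      (𝓝 (∫ v, f (v + i h) ∂μ)) := by
    refine tendsto_integral_of_dominated_convergence (fun _ => ‖f‖)
      (fun n => (f.continuous.comp (by fun_prop)).aestronglyMeasurable) (integrable_const _)
      (fun n => ae_of_all _ fun v => f.norm_coe_le_norm _) (ae_of_all _ fun v => ?_)
    have h1 : Tendsto (fun n => v + i (dualEmb i (φ n))) atTop (𝓝 (v + i h)) :=
      ((i.continuous.tendsto h).comp hzh).const_add v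
    exact (f.continuous.tendsto _).comp h1
  have hf2 : Tendsto (fun n => ⟪hfL.toLp f, u n⟫) atTop (𝓝 ⟪hfL.toLp f, D⟫) :=
    tendsto_const_nhds.inner hD
  have hf3 : ∀ n, ∫ v, f (v + i (dualEmb i (φ n))) ∂μ = ⟪hfL.toLp f, u n⟫ := by
    intro n
    rw [← integral_map (hmeas _).aemeasurable f.continuous.aestronglyMeasurable,
      hμ.map_add_dualEmb, integral_withDensity_eq_integral_toReal_smul
      (continuous_cmDensity _).measurable.ennreal_ofReal (by simp), L2.inner_def]
    refine integral_congr_ae ?_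
    filter_upwards [(hμ.memLp_cmDensity (φ n)).coeFn_toLp, hfL.coeFn_toLp] with v h1 h2
    rw [h1, h2, ENNReal.toReal_ofReal (cmDensity_pos _ _).le]
    simp
  simp_rw [hf3] at hf1
  rw [integral_map (hmeas _).aemeasurable f.continuous.aestronglyMeasurable,
    tendsto_nhds_unique hf1 hf2, integral_withDensity_eq_integral_toReal_smul₀
      (Lp.stronglyMeasurable D).measurable.aemeasurable.ennreal_ofReal (by simp), L2.inner_def]
  refine integral_congr_ae ?_
  filter_upwards [hfL.coeFn_toLp, (Lp.coeFn_nonneg D).2 hD0] with v h1 h2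
  rw [h1, ENNReal.toReal_ofReal h2]
  simp

end CameronMartin

/-! ### Likelihood and Bayes' formula -/

section DualLift

/-- The image of `W*` in `H` is a countable union of the closed sets
`{z | ∀ h, |(z, h)| ≤ n |i h|}`, by the Hahn-Banach theorem. -/
theorem measurableSet_range_dualEmb {W H : Type*} [NormedAddCommGroup W] [NormedSpace ℝ W]
    [NormedAddCommGroup H] [InnerProductSpace ℝ H] [CompleteSpace H] [MeasurableSpace H]
    [BorelSpace H] {i : H →L[ℝ] W} (hi : Function.Injective i) :
    MeasurableSet (Set.range (dualEmb i)) := by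
  have h1 : Set.range (dualEmb i) = ⋃ n : ℕ, ⋂ h : H, {z | |⟪z, h⟫| ≤ n * ‖i h‖} := by
    ext z
    simp only [Set.mem_range, Set.mem_iUnion, Set.mem_iInter, Set.mem_ofPred_eq]
    constructor
    · rintro ⟨φ, rfl⟩
      obtain ⟨n, hn⟩ := exists_nat_ge ‖φ‖
      refine ⟨n, fun h => ?_⟩
      rw [inner_dualEmb]
      exact (φ.le_opNorm _).trans (mul_le_mul_of_nonneg_right hn (norm_nonneg _))
    · rintro ⟨n, hn⟩
      let e := LinearEquiv.ofInjective (i : H →ₗ[ℝ] W) hi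
      let f : StrongDual ℝ (LinearMap.range (i : H →ₗ[ℝ] W)) :=
        ((innerₗ H z).comp (e.symm : _ →ₗ[ℝ] H)).mkContinuous n fun v => by
          obtain ⟨h, rfl⟩ := e.surjective v
          simpa [e] using hn h
      obtain ⟨φ, hφ, -⟩ := _root_.exists_extension_norm_eq _ f
      refine ⟨φ, ext_inner_right ℝ fun h => ?_⟩
      rw [inner_dualEmb]
      have := hφ (e h)
      simpa [f, e] using this
  rw [h1]
  refine MeasurableSet.iUnion fun n => (isClosed_iInter fun h => ?_).measurableSet
  exact isClosed_le (by fun_prop) (by fun_prop)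

variable {W H : Type*} [NormedAddCommGroup W] [NormedSpace ℝ W]
  [MeasurableSpace W] [BorelSpace W]
  [NormedAddCommGroup H] [InnerProductSpace ℝ H] [CompleteSpace H] [SecondCountableTopology H]
  [MeasurableSpace H] [BorelSpace H]

/-- A measure on `H` carried by `W*` admits a jointly measurable pairing of its points with the
points of `W`. The pairing is a limit of inner products because `H` is dense in `W`. -/
theorem exists_measurable_dual_lift {i : H →L[ℝ] W} (hi : DenseRange i) (ν : Measure H)
    (hν : ∀ᵐ z ∂ν, z ∈ Set.range (dualEmb i)) :
    ∃ Φ : H → StrongDual ℝ W, Measurable (fun p : W × H => Φ p.2 p.1) ∧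
      ∀ᵐ z ∂ν, dualEmb i (Φ z) = z := by
  classical
  obtain ⟨S, hSsub, hS, hSν⟩ := exists_measurable_superset_of_null (mem_ae_iff.1 hν)
  have hlift : ∀ z ∉ S, ∃ φ, dualEmb i φ = z := fun z hz => by
    by_contra hcon
    exact hz (hSsub hcon)
  choose φ hφ using hlift
  let Φ : H → StrongDual ℝ W := fun z => if hz : z ∈ S then 0 else φ z hz
  have hΦS : ∀ z ∉ S, dualEmb i (Φ z) = z := fun z hz => by
    simp only [Φ, hz, dite_false, hφ]
  refine ⟨Φ, ?_, ?_⟩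
  · let e : ℕ → H := TopologicalSpace.denseSeq H
    have he : DenseRange (fun n => i (e n)) :=
      hi.comp (TopologicalSpace.denseRange_denseSeq H) i.continuous
    let N : ℕ → W → ℕ := fun n => SimpleFunc.nearestPtInd (fun n => i (e n)) n
    have hN : ∀ n, Measurable (N n) := fun n => SimpleFunc.measurable _
    refine measurable_of_tendsto_metrizable
      (f := fun n (p : W × H) => Sᶜ.indicator (fun z => ⟪z, e (N n p.1)⟫) p.2) (fun n => ?_) ?_
    · have h1 : Measurable (fun p : W × H => ⟪p.2, e (N n p.1)⟫) :=
        measurable_snd.inner ((measurable_from_nat.comp (hN n)).comp measurable_fst)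
      exact h1.indicator (measurable_snd hS.compl)
    · rw [tendsto_pi_nhds]
      rintro ⟨v, z⟩
      by_cases hz : z ∈ S
      · simp [Φ, hz]
      · have h1 : Tendsto (fun n => i (e (N n v))) atTop (𝓝 v) :=
          SimpleFunc.tendsto_nearestPt (e := fun n => i (e n)) (he v)
        have h2 : ∀ n, Sᶜ.indicator (fun z => ⟪z, e (N n v)⟫) z = Φ z (i (e (N n v))) := by
          intro n
          rw [Set.indicator_of_mem (by exact hz), ← inner_dualEmb, hΦS z hz]
        simp only [h2]
        exact ((Φ z).continuous.tendsto v).comp h1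
  · exact (measure_eq_zero_iff_ae_notMem.1 hSν).mono hΦS

end DualLift

section Likelihood

variable {W H : Type*} [NormedAddCommGroup W] [NormedSpace ℝ W]
  [NormedAddCommGroup H]

/-- The likelihood of the signal `z ∈ H` given the observation `v ∈ W`, where `Φ z ∈ W*` represents
`z`. -/
noncomputable def lik (ρ : ℝ) (Φ : H → StrongDual ℝ W) (v : W) (z : H) : ℝ :=
  Real.exp (ρ * Φ z v - ρ ^ 2 * ‖z‖ ^ 2 / 2)

lemma lik_pos (ρ : ℝ) (Φ : H → StrongDual ℝ W) (v : W) (z : H) : 0 < lik ρ Φ v z :=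
  Real.exp_pos _

/-- The total likelihood of the observation `v`, if the signal has law `ν`. -/
noncomputable def totalLik [MeasurableSpace H] (ρ : ℝ) (Φ : H → StrongDual ℝ W) (ν : Measure H)
    (v : W) : ENNReal :=
  ∫⁻ z, ENNReal.ofReal (lik ρ Φ v z) ∂ν

variable [MeasurableSpace W] [MeasurableSpace H] [OpensMeasurableSpace H]
  {Φ : H → StrongDual ℝ W} {ν : Measure H} {ρ : ℝ}

lemma measurable_lik (hΦ : Measurable (fun p : W × H => Φ p.2 p.1)) :
    Measurable (fun p : W × H => lik ρ Φ p.1 p.2) := by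
  unfold lik
  exact ((hΦ.const_mul ρ).sub
    (((measurable_snd.norm.pow_const 2).const_mul (ρ ^ 2)).div_const 2)).exp

lemma measurable_lik_right (hΦ : Measurable (fun p : W × H => Φ p.2 p.1)) (v : W) :
    Measurable (lik ρ Φ v) :=
  Measurable.of_uncurry_left (f := lik ρ Φ) (measurable_lik hΦ)

lemma measurable_totalLik (hΦ : Measurable (fun p : W × H => Φ p.2 p.1)) [SFinite ν] :
    Measurable (totalLik ρ Φ ν) :=
  (measurable_lik hΦ).ennreal_ofReal.lintegral_prod_right'

lemma totalLik_pos (hΦ : Measurable (fun p : W × H => Φ p.2 p.1)) [IsProbabilityMeasure ν]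
    (v : W) : 0 < totalLik ρ Φ ν v := by
  have hL : Measurable (fun z => ENNReal.ofReal (lik ρ Φ v z)) :=
    (measurable_lik_right hΦ v).ennreal_ofReal
  rw [totalLik, lintegral_pos_iff_support hL]
  have : Function.support (fun z => ENNReal.ofReal (lik ρ Φ v z)) = Set.univ :=
    Set.eq_univ_of_forall fun z => by simp [lik_pos]
  rw [this]
  simp

end Likelihood

section Bayes

variable {W H : Type*} [NormedAddCommGroup W] [NormedSpace ℝ W]
  [NormedAddCommGroup H] [InnerProductSpace ℝ H] [CompleteSpace H]
  {i : H →L[ℝ] W} {Φ : H → StrongDual ℝ W} {ρ : ℝ}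

lemma lik_eq_cmDensity {ρ : ℝ} {z : H} (hz : dualEmb i (Φ z) = z) (v : W) :
    lik ρ Φ v z = cmDensity i (ρ • Φ z) v := by
  rw [lik, cmDensity, dualEmb_smul, hz, norm_smul, mul_pow, Real.norm_eq_abs, sq_abs]
  simp

lemma lik_add_smul {ρ : ℝ} {z : H} (hz : dualEmb i (Φ z) = z) (v : W) (t : ℝ) (h : H) :
    lik ρ Φ (v + t • i h) z = lik ρ Φ v z * Real.exp (t * (ρ * ⟪h, z⟫)) := by
  have : Φ z (i h) = ⟪h, z⟫ := by rw [← inner_dualEmb, hz, real_inner_comm]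
  rw [lik, lik, ← Real.exp_add, map_add, map_smul, this, smul_eq_mul]
  congr 1
  ring

/-- The hypotheses on the additive Gaussian channel with signal `x` and noise `w`, together with a
jointly measurable choice `Φ z ∈ W*` of a functional representing almost every signal `z`. -/
structure IsLiftedChannel {W H Ω : Type*} [NormedAddCommGroup W] [NormedSpace ℝ W]
    [NormedAddCommGroup H] [InnerProductSpace ℝ H] [CompleteSpace H] [MeasurableSpace W]
    [MeasurableSpace H] [MeasurableSpace Ω] (i : H →L[ℝ] W) (μ : Measure W) (P : Measure Ω)
    (x : Ω → H) (w : Ω → W) (Φ : H → StrongDual ℝ W) : Prop where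
  wiener : IsAbstractWienerSpace i μ
  measurable_signal : Measurable x
  measurable_noise : Measurable w
  indep : IndepFun x w P
  map_noise : P.map w = μ
  measurable_lift : Measurable (fun p : W × H => Φ p.2 p.1)
  lift_eq : ∀ᵐ z ∂(P.map x), dualEmb i (Φ z) = z

variable [MeasurableSpace W] [BorelSpace W] [SecondCountableTopology W]
  [MeasurableSpace H] [BorelSpace H]
  {Ω : Type*} [MeasurableSpace Ω] {P : Measure Ω} {μ : Measure W} {x : Ω → H} {w : Ω → W}

lemma IsLiftedChannel.measurable_channel (hc : IsLiftedChannel i μ P x w Φ) :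
    Measurable (channel i ρ x w) :=
  ((i.continuous.measurable.comp hc.measurable_signal).const_smul ρ).add hc.measurable_noise

variable [CompleteSpace W]

/-- The joint law of output and signal has the likelihood as its density. -/
theorem map_channel_prodMk_eq_withDensity [IsProbabilityMeasure P]
    (hc : IsLiftedChannel i μ P x w Φ) :
    P.map (fun ω => (channel i ρ x w ω, x ω)) =
      (μ.prod (P.map x)).withDensity (fun p => ENNReal.ofReal (lik ρ Φ p.1 p.2)) := by
  have := hc.wiener.isProbabilityMeasure
  have : IsProbabilityMeasure (P.map x) :=
    Measure.isProbabilityMeasure_map hc.measurable_signal.aemeasurable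
  have hL := (measurable_lik (ρ := ρ) hc.measurable_lift).ennreal_ofReal
  have hg : Measurable (fun p : H × W => (ρ • i p.1 + p.2, p.1)) := by fun_prop
  have hmap : P.map (fun ω => (channel i ρ x w ω, x ω)) =
      ((P.map x).prod μ).map (fun p : H × W => (ρ • i p.1 + p.2, p.1)) := by
    rw [← hc.map_noise, ← (indepFun_iff_map_prod_eq_prod_map_map
      hc.measurable_signal.aemeasurable hc.measurable_noise.aemeasurable).1 hc.indep,
      Measure.map_map hg (hc.measurable_signal.prodMk hc.measurable_noise)]
    rfl
  rw [hmap]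
  rw [Measure.ext_iff_lintegral]
  intro f hf
  have hfg : Measurable (fun p : H × W => f (ρ • i p.1 + p.2, p.1)) := hf.comp hg
  rw [lintegral_map hf hg, lintegral_prod _ hfg.aemeasurable,
    lintegral_withDensity_eq_lintegral_mul _ hL hf,
    lintegral_prod_symm' _ (hL.mul hf)]
  -- for a fixed signal `z` the output is the noise shifted by `ρ z`
  refine lintegral_congr_ae ?_
  filter_upwards [hc.lift_eq] with z hz
  have hfz : Measurable (fun v => f (v, z)) := hf.comp measurable_prodMk_right
  have hcm := hc.wiener.map_add_dualEmb (ρ • Φ z)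
  have h1 : ∫⁻ v, f (v, z) ∂(μ.map (fun v => v + i (dualEmb i (ρ • Φ z)))) =
      ∫⁻ v, f (ρ • i z + v, z) ∂μ := by
    rw [lintegral_map hfz (by fun_prop)]
    simp only [dualEmb_smul, hz, map_smul, add_comm]
  rw [← h1, hcm, lintegral_withDensity_eq_lintegral_mul _
    (continuous_cmDensity _).measurable.ennreal_ofReal hfz]
  simp only [Pi.mul_apply, lik_eq_cmDensity hz]

/-- The law of the output has the total likelihood as its density. -/
theorem map_channel_eq_withDensity [IsProbabilityMeasure P]
    (hc : IsLiftedChannel i μ P x w Φ) :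
    P.map (channel i ρ x w) = μ.withDensity (totalLik ρ Φ (P.map x)) := by
  have := hc.wiener.isProbabilityMeasure
  have hL := (measurable_lik (ρ := ρ) hc.measurable_lift).ennreal_ofReal
  have hy := hc.measurable_channel (ρ := ρ)
  have h := map_channel_prodMk_eq_withDensity (ρ := ρ) hc
  have h1 : P.map (channel i ρ x w) =
      (P.map (fun ω => (channel i ρ x w ω, x ω))).map Prod.fst := by
    rw [Measure.map_map measurable_fst (hy.prodMk hc.measurable_signal)]; rfl
  rw [h1, h]
  rw [Measure.ext_iff_lintegral]
  intro f hf
  have hf1 : Measurable (fun p : W × H => f p.1) := hf.comp measurable_fst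
  rw [lintegral_map hf measurable_fst, lintegral_withDensity_eq_lintegral_mul _ hL hf1,
    lintegral_withDensity_eq_lintegral_mul _ (measurable_totalLik hc.measurable_lift) hf,
    lintegral_prod _ (hL.mul hf1).aemeasurable]
  refine lintegral_congr fun v => ?_
  have hLv : Measurable (fun z => ENNReal.ofReal (lik ρ Φ v z)) :=
    (measurable_lik_right hc.measurable_lift v).ennreal_ofReal
  simp only [Pi.mul_apply, totalLik]
  rw [lintegral_mul_const _ hLv]

lemma ae_totalLik_lt_top [IsProbabilityMeasure P]
    (hc : IsLiftedChannel i μ P x w Φ) :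
    ∀ᵐ v ∂μ, totalLik ρ Φ (P.map x) v < ⊤ := by
  have hy := hc.measurable_channel (ρ := ρ)
  refine ae_lt_top (measurable_totalLik hc.measurable_lift) ?_
  have h := map_channel_eq_withDensity (ρ := ρ) hc
  have : IsProbabilityMeasure (P.map (channel i ρ x w)) :=
    Measure.isProbabilityMeasure_map hy.aemeasurable
  rw [← setLIntegral_univ, ← withDensity_apply _ MeasurableSet.univ, ← h, measure_univ]
  simp

lemma likelihoodRatio_ae_eq [IsProbabilityMeasure P]
    (hc : IsLiftedChannel i μ P x w Φ) :
    likelihoodRatio P (channel i ρ x w) μ =ᵐ[μ]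
      fun v => (totalLik ρ Φ (P.map x) v).toReal := by
  have := hc.wiener.isProbabilityMeasure
  have h := Measure.rnDeriv_withDensity μ
    (measurable_totalLik (ρ := ρ) (ν := P.map x) hc.measurable_lift)
  rw [← map_channel_eq_withDensity (ρ := ρ) hc] at h
  filter_upwards [h] with v hv
  rw [likelihoodRatio, hv]

variable [SecondCountableTopology H]

/-- **Bayes' formula**: the conditional law of the signal is the law of the signal reweighted by
the likelihood. -/
theorem condDistrib_ae_eq [IsProbabilityMeasure P]
    (hc : IsLiftedChannel i μ P x w Φ) :
    ∀ᵐ v ∂μ, condDistrib x (channel i ρ x w) P v = (P.map x).withDensity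
      (fun z => (totalLik ρ Φ (P.map x) v)⁻¹ * ENNReal.ofReal (lik ρ Φ v z)) := by
  have := hc.wiener.isProbabilityMeasure
  have : IsProbabilityMeasure (P.map x) :=
    Measure.isProbabilityMeasure_map hc.measurable_signal.aemeasurable
  have hL := (measurable_lik (ρ := ρ) hc.measurable_lift).ennreal_ofReal
  have hT := measurable_totalLik (ρ := ρ) (ν := P.map x) hc.measurable_lift
  have hy := hc.measurable_channel (ρ := ρ)
  have hpos : ∀ v, 0 < totalLik ρ Φ (P.map x) v := totalLik_pos hc.measurable_lift
  have hd : Measurable (fun p : W × H =>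
      (totalLik ρ Φ (P.map x) p.1)⁻¹ * ENNReal.ofReal (lik ρ Φ p.1 p.2)) :=
    (hT.comp measurable_fst).inv.mul hL
  let κ : Kernel W H := Kernel.withDensity (Kernel.const W (P.map x))
    (fun v z => (totalLik ρ Φ (P.map x) v)⁻¹ * ENNReal.ofReal (lik ρ Φ v z))
  have hκ : ∀ v, κ v = (P.map x).withDensity
      (fun z => (totalLik ρ Φ (P.map x) v)⁻¹ * ENNReal.ofReal (lik ρ Φ v z)) := by
    intro v
    rw [Kernel.withDensity_apply _ hd, Kernel.const_apply]
  have hLv : ∀ v, Measurable (fun z => ENNReal.ofReal (lik ρ Φ v z)) := fun v =>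
    (measurable_lik_right hc.measurable_lift v).ennreal_ofReal
  have : IsFiniteKernel κ := by
    refine ⟨1, ENNReal.one_lt_top, fun v => ?_⟩
    rw [hκ, withDensity_apply _ MeasurableSet.univ, setLIntegral_univ,
      lintegral_const_mul _ (hLv v)]
    exact ENNReal.inv_mul_le_one _
  have hjoint : P.map (fun ω => (channel i ρ x w ω, x ω)) = P.map (channel i ρ x w) ⊗ₘ κ := by
    rw [map_channel_prodMk_eq_withDensity hc]
    rw [Measure.ext_iff_lintegral]
    intro f hf
    rw [Measure.lintegral_compProd hf, map_channel_eq_withDensity hc,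
      lintegral_withDensity_eq_lintegral_mul _ hL hf,
      lintegral_withDensity_eq_lintegral_mul _ hT (by exact hf.lintegral_kernel_prod_right'),
      lintegral_prod _ (hL.mul hf).aemeasurable]
    refine lintegral_congr_ae ?_
    filter_upwards [ae_totalLik_lt_top (ρ := ρ) hc] with v hv
    have hfv : Measurable (fun z => f (v, z)) := hf.comp measurable_prodMk_left
    simp only [Pi.mul_apply]
    rw [hκ, lintegral_withDensity_eq_lintegral_mul _ ((hLv v).const_mul _) hfv]
    simp only [Pi.mul_apply, mul_assoc]
    have hLf : Measurable (fun z => ENNReal.ofReal (lik ρ Φ v z) * f (v, z)) := (hLv v).mul hfv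
    rw [lintegral_const_mul _ hLf, ← mul_assoc,
      ENNReal.mul_inv_cancel (hpos v).ne' hv.ne, one_mul]
  have hcd := condDistrib_ae_eq_of_measure_eq_compProd _ hc.measurable_signal.aemeasurable hjoint
  rw [map_channel_eq_withDensity hc, EventuallyEq,
    ae_withDensity_iff hT] at hcd
  filter_upwards [hcd] with v hv
  rw [hv (hpos v).ne', hκ]

end Bayes

/-! ### Differentiation along lines -/

section HasDerivAlong

lemma hasDerivAt_line {W : Type*} [NormedAddCommGroup W] [NormedSpace ℝ W] {f g : W → ℝ}
    {D : Set W} {c : W} (hD : ∀ v ∈ D, ∀ t : ℝ, v + t • c ∈ D)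
    (hfg : ∀ v ∈ D, HasDerivAt (fun t : ℝ => f (v + t • c)) (g v) 0) {v : W} (hv : v ∈ D)
    (s : ℝ) : HasDerivAt (fun t : ℝ => f (v + t • c)) (g (v + s • c)) s := by
  have h1 := hfg _ (hD v hv s)
  have h2 : HasDerivAt (fun t : ℝ => t - s) 1 s := (hasDerivAt_id s).sub_const s
  rw [← sub_self s] at h1
  have h3 := HasDerivAt.comp (h := fun t : ℝ => t - s) s h1 h2
  rw [mul_one] at h3
  refine h3.congr_of_eventuallyEq (Eventually.of_forall fun t => ?_)
  simp only [Function.comp_apply]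
  congr 1
  module

variable {W H : Type*} [NormedAddCommGroup W] [NormedSpace ℝ W] [MeasurableSpace W]
  [NormedAddCommGroup H] [InnerProductSpace ℝ H] {i : H →L[ℝ] W} {μ : Measure W}
  {h : H} {F F' G G' f g : W → ℝ}

lemma HasDerivAlong.ae_unique (h₁ : HasDerivAlong i μ h F G) (h₂ : HasDerivAlong i μ h F G') :
    G =ᵐ[μ] G' :=
  tendstoInMeasure_ae_unique h₁.tendsto_quotient h₂.tendsto_quotient

variable [CompleteSpace H] [BorelSpace W]

/-- If `D` is a set of full measure that contains with a point the whole line with direction `h`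
through it, then a continuous pointwise derivative along these lines is a derivative in the sense
of `HasDerivAlong`. The version of `f` which vanishes off `D` is absolutely continuous on every
line. -/
theorem HasDerivAlong.of_hasDerivAt (hμ : IsAbstractWienerSpace i μ) {D : Set W}
    (hf : Measurable f) (hg : Measurable g) (hDμ : ∀ᵐ v ∂μ, v ∈ D)
    (hD : ∀ v ∈ D, ∀ t : ℝ, v + t • i h ∈ D)
    (hfg : ∀ v ∈ D, HasDerivAt (fun t : ℝ => f (v + t • i h)) (g v) 0)
    (hgc : ∀ v ∈ D, Continuous fun t : ℝ => g (v + t • i h)) : HasDerivAlong i μ h f g where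
  aemeasurable := hf.aemeasurable
  aemeasurable_deriv := hg.aemeasurable
  ray_absolutelyContinuous := by
    refine ⟨D.indicator f, ?_, fun v a b => ?_⟩
    · filter_upwards [hDμ] with v hv
      rw [Set.indicator_of_mem hv]
    · by_cases hv : v ∈ D
      · have h1 : (fun t : ℝ => D.indicator f (v + t • i h)) = fun t => f (v + t • i h) :=
          funext fun t => Set.indicator_of_mem (hD v hv t) f
        rw [h1]
        refine (contDiff_one_iff_deriv.2 ⟨fun s => (hasDerivAt_line hD hfg hv s).differentiableAt,
          ?_⟩).contDiffOn.absolutelyContinuousOnInterval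
        rw [funext fun s => (hasDerivAt_line hD hfg hv s).deriv]
        exact hgc v hv
      · have h1 : (fun t : ℝ => D.indicator f (v + t • i h)) = fun _ => 0 := by
          refine funext fun t => Set.indicator_of_notMem (fun ht => hv ?_) f
          have := hD _ ht (-t)
          rwa [neg_smul, add_neg_cancel_right] at this
        rw [h1]
        exact contDiffOn_const.absolutelyContinuousOnInterval
  tendsto_quotient := by
    have := hμ.isProbabilityMeasure
    intro ε hε
    refine tendsto_of_seq_tendsto fun u hu => ?_
    refine tendstoInMeasure_of_tendsto_ae
      (f := fun n v => (f (v + u n • i h) - f v) / u n) (fun n => ?_) ?_ ε hε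
    · have : Measurable fun v => f (v + u n • i h) := hf.comp (measurable_add_const _)
      exact ((this.sub hf).div_const _).aestronglyMeasurable
    · filter_upwards [hDμ] with v hv
      have h1 := (hasDerivAt_iff_tendsto_slope.1 (hfg v hv)).comp hu
      refine h1.congr fun n => ?_
      simp [slope_def_field]

/-- A random variable that is constant has derivative zero. -/
lemma HasDerivAlong.const (hμ : IsAbstractWienerSpace i μ) (c : ℝ) :
    HasDerivAlong i μ h (fun _ => c) (fun _ => 0) :=
  .of_hasDerivAt hμ (D := Set.univ) measurable_const measurable_const (by simp) (by simp)
    (fun _ _ => hasDerivAt_const _ _) (fun _ _ => continuous_const)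

variable [CompleteSpace W] [SecondCountableTopology W]

lemma IsAbstractWienerSpace.ae_add (hμ : IsAbstractWienerSpace i μ) {p : W → Prop}
    (hp : ∀ᵐ v ∂μ, p v) (h : H) (t : ℝ) : ∀ᵐ v ∂μ, p (v + t • i h) := by
  rw [← map_smul]
  exact ae_of_ae_map (by fun_prop) ((hμ.map_add_absolutelyContinuous (t • h)).ae_le hp)

lemma HasDerivAlong.congr (hμ : IsAbstractWienerSpace i μ) (hFG : HasDerivAlong i μ h F G)
    (hF : F =ᵐ[μ] F') (hG : G =ᵐ[μ] G') : HasDerivAlong i μ h F' G' where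
  aemeasurable := hFG.aemeasurable.congr hF
  aemeasurable_deriv := hFG.aemeasurable_deriv.congr hG
  ray_absolutelyContinuous := by
    obtain ⟨f, hf, hac⟩ := hFG.ray_absolutelyContinuous
    exact ⟨f, hf.trans hF, hac⟩
  tendsto_quotient := by
    refine TendstoInMeasure.congr (fun t => ?_) hG hFG.tendsto_quotient
    filter_upwards [hF, hμ.ae_add hF h t] with v h1 h2
    rw [h1, h2]

end HasDerivAlong

section Weighted

variable {W H : Type*} [NormedAddCommGroup W] [NormedSpace ℝ W] [NormedAddCommGroup H]
  [MeasurableSpace H] [MeasurableSpace W] [OpensMeasurableSpace H] {Φ : H → StrongDual ℝ W}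
  {ν : Measure H} {ρ : ℝ} {v : W}

/-- The exponential moments of a sum of two functions are controlled by those of the summands,
since `exp (a + b) ≤ exp (2 a) + exp (2 b)`. -/
lemma integrable_lik_mul_exp_add (hΦ : Measurable (fun p : W × H => Φ p.2 p.1)) {a b : H → ℝ}
    (ha : Measurable a) (hb : Measurable b)
    (hae : ∀ t : ℝ, Integrable (fun z => lik ρ Φ v z * Real.exp (t * a z)) ν)
    (hbe : ∀ t : ℝ, Integrable (fun z => lik ρ Φ v z * Real.exp (t * b z)) ν) (t : ℝ) :
    Integrable (fun z => lik ρ Φ v z * Real.exp (t * (a z + b z))) ν := by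
  have hL := measurable_lik_right (ρ := ρ) hΦ v
  refine ((hae (2 * t)).add (hbe (2 * t))).mono'
    (hL.mul ((ha.add hb).const_mul t).exp).aestronglyMeasurable (ae_of_all _ fun z => ?_)
  have hp := lik_pos ρ Φ v z
  rw [Real.norm_of_nonneg (by positivity), Pi.add_apply, ← mul_add]
  refine mul_le_mul_of_nonneg_left ?_ hp.le
  have h1 : Real.exp (t * (a z + b z)) = Real.exp (t * a z) * Real.exp (t * b z) := by
    rw [← Real.exp_add, mul_add]
  have h2 : Real.exp (2 * t * a z) = Real.exp (t * a z) ^ 2 := by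
    rw [← Real.exp_nat_mul]; congr 1; push_cast; ring
  have h3 : Real.exp (2 * t * b z) = Real.exp (t * b z) ^ 2 := by
    rw [← Real.exp_nat_mul]; congr 1; push_cast; ring
  rw [h1, h2, h3]
  nlinarith [sq_nonneg (Real.exp (t * a z) - Real.exp (t * b z)),
    sq_nonneg (Real.exp (t * a z)), sq_nonneg (Real.exp (t * b z))]

lemma integrable_lik_mul_exp_abs (hΦ : Measurable (fun p : W × H => Φ p.2 p.1)) {a : H → ℝ}
    (ha : Measurable a)
    (hae : ∀ t : ℝ, Integrable (fun z => lik ρ Φ v z * Real.exp (t * a z)) ν) (t : ℝ) :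
    Integrable (fun z => lik ρ Φ v z * Real.exp (t * |a z|)) ν := by
  have hL := measurable_lik_right (ρ := ρ) hΦ v
  refine ((hae t).add (hae (-t))).mono'
    (hL.mul (ha.abs.const_mul t).exp).aestronglyMeasurable (ae_of_all _ fun z => ?_)
  have hp := lik_pos ρ Φ v z
  rw [Real.norm_of_nonneg (by positivity), Pi.add_apply, ← mul_add]
  refine mul_le_mul_of_nonneg_left ?_ hp.le
  rcases abs_cases (a z) with ⟨h, -⟩ | ⟨h, -⟩ <;> rw [h]
  · linarith [Real.exp_pos (-t * a z)]
  · rw [mul_neg, neg_mul]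
    linarith [Real.exp_pos (t * a z)]

lemma integrable_lik_of_totalLik_lt_top (hΦ : Measurable (fun p : W × H => Φ p.2 p.1)) {v : W}
    (hv : totalLik ρ Φ ν v < ⊤) : Integrable (lik ρ Φ v) ν :=
  ⟨(measurable_lik_right hΦ v).aestronglyMeasurable,
    (hasFiniteIntegral_iff_ofReal (ae_of_all _ fun z => (lik_pos ρ Φ v z).le)).2 hv⟩

end Weighted

section Domain

lemma abs_prod_le_exp_sum {H : Type*} [NormedAddCommGroup H] [InnerProductSpace ℝ H] {n : ℕ}
    (h : Fin n → H) (z : H) :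
    |∏ k, ⟪h k, z⟫| ≤ Real.exp (∑ k, |⟪h k, z⟫|) := by
  rw [Finset.abs_prod, Real.exp_sum]
  refine Finset.prod_le_prod (fun _ _ => abs_nonneg _) fun k _ => ?_
  linarith [Real.add_one_le_exp |⟪h k, z⟫|]

variable {W H : Type*} [NormedAddCommGroup W] [NormedSpace ℝ W]
  [NormedAddCommGroup H] [InnerProductSpace ℝ H] [MeasurableSpace H]

/-- The unnormalized posterior moment `∫ ∏ (h_k, z) L(v, z) ν(dz)`. It is the junk value `0` for
those `v` at which the integral diverges. -/
noncomputable def likMoment (ρ : ℝ) (Φ : H → StrongDual ℝ W) (ν : Measure H) (n : ℕ)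
    (h : Fin n → H) (v : W) : ℝ :=
  ∫ z, lik ρ Φ v z * ∏ k, ⟪h k, z⟫ ∂ν

/-- The observations `v` for which the linear functionals `(g, ·)`, `g ∈ s`, have all exponential
moments under the unnormalized posterior. -/
def expDomain (ρ : ℝ) (Φ : H → StrongDual ℝ W) (ν : Measure H) (s : Set H) : Set W :=
  {v | Integrable (lik ρ Φ v) ν ∧
    ∀ g ∈ s, ∀ t : ℝ, Integrable (fun z => lik ρ Φ v z * Real.exp (t * ⟪g, z⟫)) ν}

variable [MeasurableSpace W] [BorelSpace H] {Φ : H → StrongDual ℝ W} {ν : Measure H} {ρ : ℝ}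
  {v : W} {s : Set H}

lemma integrable_lik_mul_exp_sum (hΦ : Measurable (fun p : W × H => Φ p.2 p.1))
    (hv : v ∈ expDomain ρ Φ ν s) {ι : Type*} (S : Finset ι) (g : ι → H) (hg : ∀ k, g k ∈ s)
    (t : ℝ) :
    Integrable (fun z => lik ρ Φ v z * Real.exp (t * ∑ k ∈ S, |⟪g k, z⟫|)) ν := by
  classical
  induction S using Finset.induction_on generalizing t with
  | empty => simpa using hv.1
  | insert k S hk ih =>
    simp only [Finset.sum_insert hk]
    refine integrable_lik_mul_exp_add hΦ (by fun_prop) (by fun_prop) ?_ ih t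
    exact integrable_lik_mul_exp_abs hΦ (by fun_prop) (hv.2 _ (hg k))

lemma integrable_lik_mul_prod (hΦ : Measurable (fun p : W × H => Φ p.2 p.1))
    (hv : v ∈ expDomain ρ Φ ν s) {n : ℕ} (h : Fin n → H) (hh : ∀ k, h k ∈ s) :
    Integrable (fun z => lik ρ Φ v z * ∏ k, ⟪h k, z⟫) ν := by
  refine (integrable_lik_mul_exp_sum hΦ hv Finset.univ h hh 1).mono'
    ((measurable_lik_right hΦ v).mul (by fun_prop)).aestronglyMeasurable (ae_of_all _ fun z => ?_)
  rw [norm_mul, Real.norm_of_nonneg (lik_pos ρ Φ v z).le, one_mul]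
  exact mul_le_mul_of_nonneg_left (abs_prod_le_exp_sum h z) (lik_pos ρ Φ v z).le

variable [CompleteSpace H] {i : H →L[ℝ] W}

lemma add_smul_mem_expDomain (hΦ : Measurable (fun p : W × H => Φ p.2 p.1))
    (hlift : ∀ᵐ z ∂ν, dualEmb i (Φ z) = z) (hv : v ∈ expDomain ρ Φ ν s) {g : H} (hg : g ∈ s)
    (t : ℝ) : v + t • i g ∈ expDomain ρ Φ ν s := by
  refine ⟨(hv.2 g hg (t * ρ)).congr ?_, fun g' hg' t' => ?_⟩
  · filter_upwards [hlift] with z hz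
    rw [lik_add_smul hz, mul_assoc]
  · have h1 := integrable_lik_mul_exp_add hΦ
      (a := fun z => t * ρ * ⟪g, z⟫) (b := fun z => t' * ⟪g', z⟫) (by fun_prop) (by fun_prop)
      (fun r => by simpa only [mul_assoc] using hv.2 g hg (r * (t * ρ)))
      (fun r => by simpa only [mul_assoc] using hv.2 g' hg' (r * t')) 1
    refine h1.congr ?_
    filter_upwards [hlift] with z hz
    rw [lik_add_smul hz, one_mul, Real.exp_add]
    ring_nf

/-- Differentiation under the integral sign. -/
lemma hasDerivAt_likMoment (hΦ : Measurable (fun p : W × H => Φ p.2 p.1))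
    (hlift : ∀ᵐ z ∂ν, dualEmb i (Φ z) = z) (hv : v ∈ expDomain ρ Φ ν s) {n : ℕ}
    (h : Fin (n + 1) → H) (hh : ∀ k, h k ∈ s) :
    HasDerivAt (fun t : ℝ => likMoment ρ Φ ν n (Fin.init h) (v + t • i (h (Fin.last n))))
      (ρ * likMoment ρ Φ ν (n + 1) h v) 0 := by
  set g := h (Fin.last n) with hg
  have hL := measurable_lik_right (ρ := ρ) hΦ v
  have hprod : Measurable (fun z => ∏ k, ⟪Fin.init h k, z⟫) := by fun_prop
  have hgm : Measurable (fun z => ρ * ⟪g, z⟫) := by fun_prop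
  have hint : ∀ t, likMoment ρ Φ ν n (Fin.init h) (v + t • i g) =
      ∫ z, lik ρ Φ v z * Real.exp (t * (ρ * ⟪g, z⟫)) * ∏ k, ⟪Fin.init h k, z⟫ ∂ν := by
    intro t
    refine integral_congr_ae ?_
    filter_upwards [hlift] with z hz
    rw [lik_add_smul hz]
  simp_rw [hint]
  -- for `|t| ≤ 1` one factor `exp |ρ (g, z)|` dominates the exponential and the other one dominates
  -- the factor `|ρ (g, z)|` that differentiation brings down
  have hbound : Integrable (fun z => lik ρ Φ v z *
      Real.exp (1 * (2 * |ρ * ⟪g, z⟫| + ∑ k, |⟪Fin.init h k, z⟫|))) ν := by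
    refine integrable_lik_mul_exp_add hΦ (by fun_prop) (by fun_prop) (fun r => ?_)
      (integrable_lik_mul_exp_sum hΦ hv Finset.univ _ fun k => hh _) 1
    have := integrable_lik_mul_exp_abs hΦ (a := fun z => ⟪g, z⟫) (by fun_prop)
      (hv.2 g (hh _)) (r * 2 * |ρ|)
    simpa only [abs_mul, mul_assoc] using this
  have hmain := hasDerivAt_integral_of_dominated_loc_of_deriv_le (μ := ν) (𝕜 := ℝ) (x₀ := 0)
    (s := Metric.ball 0 1)
    (F := fun t z => lik ρ Φ v z * Real.exp (t * (ρ * ⟪g, z⟫)) * ∏ k, ⟪Fin.init h k, z⟫)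
    (F' := fun t z => lik ρ Φ v z * (Real.exp (t * (ρ * ⟪g, z⟫)) * (ρ * ⟪g, z⟫)) *
      ∏ k, ⟪Fin.init h k, z⟫)
    (Metric.ball_mem_nhds 0 one_pos)
    (Eventually.of_forall fun t =>
      ((hL.mul (hgm.const_mul t).exp).mul hprod).aestronglyMeasurable)
    (by simpa using integrable_lik_mul_prod hΦ hv (Fin.init h) fun k => hh _)
    ((hL.mul ((hgm.const_mul 0).exp.mul hgm)).mul hprod).aestronglyMeasurable
    (ae_of_all _ fun z t ht => ?_) hbound (ae_of_all _ fun z t _ => ?_)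
  · refine hmain.2.congr_deriv ?_
    rw [likMoment, ← integral_const_mul]
    refine integral_congr_ae (ae_of_all _ fun z => ?_)
    simp only [Fin.prod_univ_castSucc, zero_mul, Real.exp_zero, Fin.init, ← hg]
    ring
  · have hp := lik_pos ρ Φ v z
    have ht' : |t| ≤ 1 := by
      have := mem_ball_zero_iff.1 ht
      rw [Real.norm_eq_abs] at this
      exact this.le
    rw [norm_mul, norm_mul, norm_mul, Real.norm_of_nonneg hp.le,
      Real.norm_of_nonneg (Real.exp_pos _).le, one_mul, Real.exp_add, two_mul, Real.exp_add,
      mul_assoc (lik ρ Φ v z)]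
    refine mul_le_mul_of_nonneg_left (mul_le_mul (mul_le_mul ?_ ?_ (norm_nonneg _) (by positivity))
      (abs_prod_le_exp_sum _ z) (norm_nonneg _) (by positivity)) hp.le
    · refine Real.exp_le_exp.2 ((le_abs_self _).trans ?_)
      rw [abs_mul]
      exact mul_le_of_le_one_left (abs_nonneg _) ht'
    · rw [Real.norm_eq_abs]
      linarith [Real.add_one_le_exp |ρ * ⟪g, z⟫|]
  · have h1 : HasDerivAt (fun t : ℝ => t * (ρ * ⟪g, z⟫)) (ρ * ⟪g, z⟫) t := by
      simpa using (hasDerivAt_id t).mul_const (ρ * ⟪g, z⟫)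
    exact (h1.exp.const_mul _).mul_const _

lemma hasDerivAt_likMoment_snoc (hΦ : Measurable (fun p : W × H => Φ p.2 p.1))
    (hlift : ∀ᵐ z ∂ν, dualEmb i (Φ z) = z) (hv : v ∈ expDomain ρ Φ ν s) {n : ℕ}
    (h : Fin n → H) (hh : ∀ k, h k ∈ s) {g : H} (hg : g ∈ s) :
    HasDerivAt (fun t : ℝ => likMoment ρ Φ ν n h (v + t • i g))
      (ρ * likMoment ρ Φ ν (n + 1) (Fin.snoc (α := fun _ => H) h g) v) 0 := by
  have := hasDerivAt_likMoment hΦ hlift hv (Fin.snoc (α := fun _ => H) h g) fun k => by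
    induction k using Fin.lastCases with
    | last => simpa using hg
    | cast k => simpa using hh k
  simpa using this

lemma hasDerivAt_likMoment_zero (hΦ : Measurable (fun p : W × H => Φ p.2 p.1))
    (hlift : ∀ᵐ z ∂ν, dualEmb i (Φ z) = z) (hv : v ∈ expDomain ρ Φ ν s) {g : H} (hg : g ∈ s) :
    HasDerivAt (fun t : ℝ => likMoment ρ Φ ν 0 ![] (v + t • i g))
      (ρ * likMoment ρ Φ ν 1 ![g] v) 0 := by
  have h1 : Fin.snoc (α := fun _ => H) ![] g = ![g] := by
    funext k
    rw [Fin.fin_one_eq_zero k]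
    exact Fin.snoc_last (α := fun _ => H) _ _
  rw [← h1]
  exact hasDerivAt_likMoment_snoc hΦ hlift hv ![] (fun k => k.elim0) hg

lemma continuous_likMoment_line (hΦ : Measurable (fun p : W × H => Φ p.2 p.1))
    (hlift : ∀ᵐ z ∂ν, dualEmb i (Φ z) = z) (hv : v ∈ expDomain ρ Φ ν s) {n : ℕ}
    (h : Fin n → H) (hh : ∀ k, h k ∈ s) {g : H} (hg : g ∈ s) :
    Continuous fun t : ℝ => likMoment ρ Φ ν n h (v + t • i g) :=
  continuous_iff_continuousAt.2 fun t =>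
    (hasDerivAt_line (fun _ hv => add_smul_mem_expDomain hΦ hlift hv hg)
      (fun _ hv => hasDerivAt_likMoment_snoc hΦ hlift hv h hh hg) hv t).continuousAt

end Domain

/-! ### Derivatives of the posterior moments -/

section Moments

lemma likMoment_zero_signal {W H : Type*} [NormedAddCommGroup W] [NormedSpace ℝ W]
    [NormedAddCommGroup H] [InnerProductSpace ℝ H] [MeasurableSpace H] {Φ : H → StrongDual ℝ W}
    {ν : Measure H} (v : W) (n : ℕ) (h : Fin n → H) :
    likMoment 0 Φ ν n h v = ∫ z, ∏ k, ⟪h k, z⟫ ∂ν := by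
  simp [likMoment, lik]

variable {W H : Type*} [NormedAddCommGroup W] [NormedSpace ℝ W] [MeasurableSpace W]
  [NormedAddCommGroup H] [InnerProductSpace ℝ H] [MeasurableSpace H] [BorelSpace H]
  {Φ : H → StrongDual ℝ W} {ν : Measure H} {ρ : ℝ}

/-- The moment of order zero is the total likelihood; both sides are zero where the latter is
infinite. -/
lemma likMoment_zero (hΦ : Measurable (fun p : W × H => Φ p.2 p.1)) (h : Fin 0 → H) (v : W) :
    likMoment ρ Φ ν 0 h v = (totalLik ρ Φ ν v).toReal := by
  simp only [likMoment, Finset.univ_eq_empty, Finset.prod_empty, mul_one]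
  exact integral_eq_lintegral_of_nonneg_ae (ae_of_all _ fun z => (lik_pos ρ Φ v z).le)
    (measurable_lik_right hΦ v).aestronglyMeasurable

lemma likMoment_zero_pos [IsProbabilityMeasure ν]
    (hΦ : Measurable (fun p : W × H => Φ p.2 p.1)) (h : Fin 0 → H) {v : W}
    (hv : Integrable (lik ρ Φ v) ν) : 0 < likMoment ρ Φ ν 0 h v := by
  rw [likMoment_zero hΦ]
  refine ENNReal.toReal_pos (totalLik_pos hΦ v).ne' ?_
  exact ((hasFiniteIntegral_iff_ofReal (ae_of_all _ fun z => (lik_pos ρ Φ v z).le)).1 hv.2).ne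

variable [SecondCountableTopology H]

lemma measurable_likMoment [SFinite ν] (hΦ : Measurable (fun p : W × H => Φ p.2 p.1)) (n : ℕ)
    (h : Fin n → H) : Measurable (likMoment ρ Φ ν n h) := by
  have h1 : Measurable (fun p : W × H => lik ρ Φ p.1 p.2 * ∏ k, ⟪h k, p.2⟫) :=
    (measurable_lik hΦ).mul
      (Finset.measurable_prod _ fun k _ => measurable_const.inner measurable_snd)
  exact (StronglyMeasurable.integral_prod_right h1.stronglyMeasurable).measurable

end Moments

section Derivatives

variable {W H : Type*} [NormedAddCommGroup W] [NormedSpace ℝ W] [CompleteSpace W]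
  [SecondCountableTopology W] [MeasurableSpace W] [BorelSpace W]
  [NormedAddCommGroup H] [InnerProductSpace ℝ H] [CompleteSpace H]
  [MeasurableSpace H] [BorelSpace H]
  {Ω : Type*} [MeasurableSpace Ω] {P : Measure Ω} [IsProbabilityMeasure P] {μ : Measure W}
  {x : Ω → H} {w : Ω → W} {i : H →L[ℝ] W} {Φ : H → StrongDual ℝ W} {ρ : ℝ}

/-- The total likelihood is finite almost everywhere, and by quasi-invariance it remains so after a
shift by any integer multiple of `g`. This is the existence of exponential moments of `(g, ·)`. -/
theorem ae_mem_expDomain (hc : IsLiftedChannel i μ P x w Φ) (hρ : ρ ≠ 0) {s : Set H}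
    (hs : s.Countable) : ∀ᵐ v ∂μ, v ∈ expDomain ρ Φ (P.map x) s := by
  have hΦ := hc.measurable_lift
  have hfin := ae_totalLik_lt_top (ρ := ρ) hc
  have hshift : ∀ᵐ v ∂μ, ∀ g ∈ s, ∀ N : ℤ, totalLik ρ Φ (P.map x) (v + (N : ℝ) • i g) < ⊤ := by
    rw [ae_ball_iff hs]
    exact fun g _ => ae_all_iff.2 fun N => hc.wiener.ae_add hfin g N
  filter_upwards [hfin, hshift] with v h0 hv
  refine ⟨integrable_lik_of_totalLik_lt_top hΦ h0, fun g hg t => ?_⟩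
  have hN : ∀ N : ℤ, Integrable
      (fun z => lik ρ Φ v z * Real.exp ((N : ℝ) * (ρ * ⟪g, z⟫))) (P.map x) := by
    intro N
    refine (integrable_lik_of_totalLik_lt_top hΦ (hv g hg N)).congr ?_
    filter_upwards [hc.lift_eq] with z hz
    rw [lik_add_smul hz]
  -- any real multiple is dominated by the two integer multiples `± N` with `|t| ≤ N |ρ|`
  obtain ⟨N, hNt⟩ := exists_nat_ge (|t| / |ρ|)
  rw [div_le_iff₀ (abs_pos.2 hρ)] at hNt
  refine ((hN N).add (hN (-N))).mono'
    ((measurable_lik_right hΦ v).mul (by fun_prop)).aestronglyMeasurable (ae_of_all _ fun z => ?_)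
  have hp := lik_pos ρ Φ v z
  rw [Real.norm_of_nonneg (by positivity), Pi.add_apply, ← mul_add]
  refine mul_le_mul_of_nonneg_left ?_ hp.le
  have h1 : t * ⟪g, z⟫ ≤ |(N : ℝ) * (ρ * ⟪g, z⟫)| := by
    refine (le_abs_self _).trans ?_
    rw [abs_mul, abs_mul, abs_mul, Nat.abs_cast, ← mul_assoc]
    exact mul_le_mul_of_nonneg_right hNt (abs_nonneg _)
  refine (Real.exp_le_exp.2 h1).trans ?_
  push_cast
  rcases abs_cases ((N : ℝ) * (ρ * ⟪g, z⟫)) with ⟨h, -⟩ | ⟨h, -⟩ <;> rw [h]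
  · linarith [Real.exp_pos (-(N : ℝ) * (ρ * ⟪g, z⟫))]
  · rw [neg_mul]
    linarith [Real.exp_pos ((N : ℝ) * (ρ * ⟪g, z⟫))]

variable [SecondCountableTopology H]

/-- `∇_h` of an unnormalized posterior moment appends the factor `ρ (h, ·)`. For `ρ = 0` the moment
may be a junk value, but it does not depend on the observation. -/
theorem hasDerivAlong_likMoment (hc : IsLiftedChannel i μ P x w Φ) (c : ℝ) {n : ℕ}
    (h : Fin (n + 1) → H) :
    HasDerivAlong i μ (h (Fin.last n))
      (fun v => c * likMoment ρ Φ (P.map x) n (Fin.init h) v)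
      (fun v => c * (ρ * likMoment ρ Φ (P.map x) (n + 1) h v)) := by
  have hΦ := hc.measurable_lift
  have hl := hc.lift_eq
  rcases eq_or_ne ρ 0 with rfl | hρ
  · simpa only [likMoment_zero_signal, zero_mul, mul_zero] using HasDerivAlong.const hc.wiener _
  have hh : ∀ k, h k ∈ Set.range h := fun k => ⟨k, rfl⟩
  refine .of_hasDerivAt hc.wiener ((measurable_likMoment hΦ _ _).const_mul c)
    (((measurable_likMoment hΦ _ _).const_mul ρ).const_mul c)
    (ae_mem_expDomain hc hρ (Set.countable_range h))
    (fun v hv => add_smul_mem_expDomain hΦ hl hv (hh _)) (fun v hv => ?_) (fun v hv => ?_)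
  · exact (hasDerivAt_likMoment hΦ hl hv h hh).const_mul c
  · exact ((continuous_likMoment_line hΦ hl hv h hh (hh _)).const_mul ρ).const_mul c

/-- The logarithmic derivative of the total likelihood. -/
theorem hasDerivAlong_log_likMoment (hc : IsLiftedChannel i μ P x w Φ) (h : H) :
    HasDerivAlong i μ h (fun v => Real.log (likMoment ρ Φ (P.map x) 0 ![] v))
      (fun v => ρ * (likMoment ρ Φ (P.map x) 1 ![h] v / likMoment ρ Φ (P.map x) 0 ![] v)) := by
  have hΦ := hc.measurable_lift
  have hl := hc.lift_eq
  have : IsProbabilityMeasure (P.map x) :=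
    Measure.isProbabilityMeasure_map hc.measurable_signal.aemeasurable
  rcases eq_or_ne ρ 0 with rfl | hρ
  · simpa only [likMoment_zero_signal, zero_mul, mul_zero] using HasDerivAlong.const hc.wiener _
  have hh : ∀ k, ![h] k ∈ Set.range ![h] := fun k => ⟨k, rfl⟩
  have h0 : ∀ k, ![] k ∈ Set.range ![h] := fun k => k.elim0
  have hD := fun v hv => add_smul_mem_expDomain (v := v) (ρ := ρ) hΦ hl hv (hh 0)
  refine .of_hasDerivAt hc.wiener (measurable_likMoment hΦ _ _).log
    (((measurable_likMoment hΦ _ _).div (measurable_likMoment hΦ _ _)).const_mul ρ)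
    (ae_mem_expDomain hc hρ (Set.countable_range ![h])) hD (fun v hv => ?_) (fun v hv => ?_)
  · have h1 : HasDerivAt (fun t : ℝ => likMoment ρ Φ (P.map x) 0 ![] (v + t • i h))
        (ρ * likMoment ρ Φ (P.map x) 1 ![h] v) 0 :=
      hasDerivAt_likMoment_zero hΦ hl hv (hh 0)
    have h2 := h1.log (by simpa using (likMoment_zero_pos hΦ ![] hv.1).ne')
    simpa [mul_div_assoc] using h2
  · exact ((continuous_likMoment_line hΦ hl hv ![h] hh (hh 0)).div
      (continuous_likMoment_line hΦ hl hv ![] h0 (hh 0))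
      fun t => (likMoment_zero_pos hΦ ![] (hD v hv t).1).ne').const_mul ρ

/-- The derivative of a normalized posterior moment, by the quotient rule. -/
theorem hasDerivAlong_likMoment_div (hc : IsLiftedChannel i μ P x w Φ) (c : ℝ) {n : ℕ}
    (h : Fin (n + 1) → H) :
    HasDerivAlong i μ (h (Fin.last n))
      (fun v => c * (likMoment ρ Φ (P.map x) n (Fin.init h) v / likMoment ρ Φ (P.map x) 0 ![] v))
      (fun v => c * (ρ * (likMoment ρ Φ (P.map x) (n + 1) h v / likMoment ρ Φ (P.map x) 0 ![] v
        - likMoment ρ Φ (P.map x) 1 ![h (Fin.last n)] v / likMoment ρ Φ (P.map x) 0 ![] v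
          * (likMoment ρ Φ (P.map x) n (Fin.init h) v
            / likMoment ρ Φ (P.map x) 0 ![] v)))) := by
  have hΦ := hc.measurable_lift
  have hl := hc.lift_eq
  have : IsProbabilityMeasure (P.map x) :=
    Measure.isProbabilityMeasure_map hc.measurable_signal.aemeasurable
  rcases eq_or_ne ρ 0 with rfl | hρ
  · simpa only [likMoment_zero_signal, zero_mul, mul_zero] using HasDerivAlong.const hc.wiener _
  set g := h (Fin.last n) with hg
  have hh : ∀ k, h k ∈ Set.range h := fun k => ⟨k, rfl⟩
  have h0 : ∀ k, ![] k ∈ Set.range h := fun k => k.elim0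
  have h1 : ∀ k, ![g] k ∈ Set.range h := fun k => ⟨Fin.last n, by simp [hg]⟩
  have hD := fun v hv => add_smul_mem_expDomain (v := v) (ρ := ρ) hΦ hl hv (hh (Fin.last n))
  have hm := fun k h => measurable_likMoment (ρ := ρ) (ν := P.map x) hΦ k h
  refine .of_hasDerivAt hc.wiener (((hm _ _).div (hm _ _)).const_mul c)
    (((((hm _ _).div (hm _ _)).sub
      (((hm _ _).div (hm _ _)).mul ((hm _ _).div (hm _ _)))).const_mul ρ).const_mul c)
    (ae_mem_expDomain hc hρ (Set.countable_range h)) hD (fun v hv => ?_) (fun v hv => ?_)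
  · have hpos := (likMoment_zero_pos hΦ ![] hv.1).ne'
    have d0 : HasDerivAt (fun t : ℝ => likMoment ρ Φ (P.map x) 0 ![] (v + t • i g))
        (ρ * likMoment ρ Φ (P.map x) 1 ![g] v) 0 :=
      hasDerivAt_likMoment_zero hΦ hl hv (hh _)
    refine (((hasDerivAt_likMoment hΦ hl hv h hh).div d0 (by simpa using hpos)).const_mul
      c).congr_deriv ?_
    simp only [zero_smul, add_zero]
    field_simp
  · have hc' := fun k h hh => continuous_likMoment_line (ρ := ρ) (n := k) hΦ hl hv h hh
      (Set.mem_range_self (Fin.last n))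
    have hne := fun t => (likMoment_zero_pos hΦ ![] (hD v hv t).1).ne'
    exact ((((hc' _ _ hh).div (hc' _ _ h0) hne).sub (((hc' _ _ h1).div (hc' _ _ h0) hne).mul
      ((hc' _ _ fun k => hh _).div (hc' _ _ h0) hne))).const_mul ρ).const_mul c

end Derivatives

/-! ### Tensor powers and Hilbert-Schmidt forms -/

section TensorPower

variable {H : Type*} [NormedAddCommGroup H] [InnerProductSpace ℝ H]

/-- The `n`-linear form `(h₁, …, hₙ) ↦ ∏ (z, h_k)`, that is, the tensor power `z ⊗ ⋯ ⊗ z`. -/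
noncomputable def powForm (n : ℕ) (z : H) : ContinuousMultilinearMap ℝ (fun _ : Fin n => H) ℝ :=
  (ContinuousMultilinearMap.mkPiAlgebra ℝ (Fin n) ℝ).compContinuousLinearMap
    fun _ => innerSL ℝ z

lemma powForm_apply (n : ℕ) (z : H) (h : Fin n → H) : powForm n z h = ∏ k, ⟪h k, z⟫ := by
  simp [powForm, real_inner_comm]

lemma continuous_powForm (n : ℕ) : Continuous (powForm n : H → _) := by
  have h1 := (ContinuousMultilinearMap.compContinuousLinearMapContinuousMultilinear ℝ
    (fun _ : Fin n => H) (fun _ : Fin n => ℝ) ℝ).cont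
  have h2 : Continuous fun z : H => (fun _ : Fin n => innerSL ℝ z) := by fun_prop
  exact (h1.comp h2).clm_apply continuous_const

lemma norm_powForm_le (n : ℕ) (z : H) : ‖powForm n z‖ ≤ ‖z‖ ^ n := by
  refine ContinuousMultilinearMap.opNorm_le_bound (by positivity) fun h => ?_
  calc ‖powForm n z h‖ = ∏ k, ‖⟪h k, z⟫‖ := by rw [powForm_apply, norm_prod]
    _ ≤ ∏ k, ‖h k‖ * ‖z‖ :=
        Finset.prod_le_prod (fun k _ => norm_nonneg _) fun k _ => norm_inner_le_norm _ _
    _ = ‖z‖ ^ n * ∏ k, ‖h k‖ := by simp [Finset.prod_mul_distrib, mul_comm]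

lemma integrable_powForm [MeasurableSpace H] [BorelSpace H] [SecondCountableTopology H]
    {κ : Measure H} {n : ℕ} (hκ : Integrable (fun z => ‖z‖ ^ n) κ) :
    Integrable (powForm n : H → _) κ :=
  hκ.mono' (continuous_powForm n).aestronglyMeasurable (ae_of_all _ (norm_powForm_le n))

lemma integral_powForm_apply [MeasurableSpace H] [BorelSpace H] [SecondCountableTopology H]
    {κ : Measure H} {n : ℕ} (hκ : Integrable (fun z => ‖z‖ ^ n) κ) (h : Fin n → H) :
    (∫ z, powForm n z ∂κ) h = ∫ z, ∏ k, ⟪h k, z⟫ ∂κ := by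
  rw [ContinuousMultilinearMap.integral_apply (integrable_powForm hκ)]
  simp_rw [powForm_apply]

lemma integrable_prod_inner [MeasurableSpace H] [BorelSpace H] [SecondCountableTopology H]
    {κ : Measure H} {n : ℕ} (hκ : Integrable (fun z => ‖z‖ ^ n) κ) (h : Fin n → H) :
    Integrable (fun z => ∏ k, ⟪h k, z⟫) κ := by
  have := (ContinuousMultilinearMap.apply ℝ (fun _ : Fin n => H) ℝ h).integrable_comp
    (integrable_powForm hκ)
  exact this.congr (ae_of_all _ fun z => powForm_apply n z h)

/-- Bessel's inequality for the tensor power. -/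
lemma sum_prod_inner_sq_le {ι : Type*} {b : ι → H} (hb : Orthonormal ℝ b) {n : ℕ}
    (S : Finset (Fin n → ι)) (z : H) :
    ∑ k ∈ S, (∏ j, ⟪b (k j), z⟫) ^ 2 ≤ (‖z‖ ^ n) ^ 2 := by
  classical
  obtain ⟨t, ht⟩ : ∃ t : Fin n → Finset ι, S ⊆ Fintype.piFinset t :=
    ⟨fun j => S.image fun k => k j, fun k hk =>
      Fintype.mem_piFinset.2 fun j => Finset.mem_image_of_mem _ hk⟩
  have hB : ∀ j, ∑ l ∈ t j, ⟪b l, z⟫ ^ 2 ≤ ‖z‖ ^ 2 := fun j => by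
    simpa using hb.sum_inner_products_le z (s := t j)
  calc ∑ k ∈ S, (∏ j, ⟪b (k j), z⟫) ^ 2
      ≤ ∑ k ∈ Fintype.piFinset t, (∏ j, ⟪b (k j), z⟫) ^ 2 :=
        Finset.sum_le_sum_of_subset_of_nonneg ht fun k _ _ => sq_nonneg _
    _ = ∏ j, ∑ l ∈ t j, ⟪b l, z⟫ ^ 2 := by
        rw [Finset.prod_univ_sum t fun _ l => ⟪b l, z⟫ ^ 2]
        simp_rw [Finset.prod_pow]
    _ ≤ ∏ _j : Fin n, ‖z‖ ^ 2 :=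
        Finset.prod_le_prod (fun j _ => Finset.sum_nonneg fun l _ => sq_nonneg _) fun j _ => hB j
    _ = (‖z‖ ^ n) ^ 2 := by
        rw [Finset.prod_const, Finset.card_univ, Fintype.card_fin, ← pow_mul, ← pow_mul, mul_comm]

/-- The mean of a random tensor power is Hilbert-Schmidt. With `a` the coefficients of the mean,
`∑ a_k² = ∫ ∑ a_k ∏ (b_{k j}, z) κ(dz) ≤ (∑ a_k²)^{1/2} ∫ |z|ⁿ κ(dz)` for finite sums, by the
inequalities of Cauchy-Schwarz and Bessel. -/
lemma isHilbertSchmidt_integral_powForm [MeasurableSpace H] [BorelSpace H]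
    [SecondCountableTopology H] {κ : Measure H} {n : ℕ}
    (hκ : Integrable (fun z => ‖z‖ ^ n) κ) (c : ℝ) :
    IsHilbertSchmidt (c • ∫ z, powForm n z ∂κ) := by
  intro ι b
  set a : (Fin n → ι) → ℝ := fun k => ∫ z, ∏ j, ⟪b (k j), z⟫ ∂κ with ha
  set M := ∫ z, ‖z‖ ^ n ∂κ with hM
  have hM0 : 0 ≤ M := integral_nonneg fun z => by positivity
  have hterm : ∀ k : Fin n → ι, ((c • ∫ z, powForm n z ∂κ) fun j => b (k j)) ^ 2 =
      c ^ 2 * a k ^ 2 := by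
    intro k
    rw [_root_.smul_apply, integral_powForm_apply hκ, smul_eq_mul, mul_pow]
  simp_rw [hterm]
  refine (summable_of_sum_le (c := M ^ 2) (fun k => sq_nonneg _) fun S => ?_).mul_left _
  set A := ∑ k ∈ S, a k ^ 2 with hA
  have hA0 : 0 ≤ A := Finset.sum_nonneg fun k _ => sq_nonneg _
  have hint : ∀ k : Fin n → ι, Integrable (fun z => ∏ j, ⟪b (k j), z⟫) κ := fun k =>
    integrable_prod_inner hκ _
  have h1 : A = ∫ z, ∑ k ∈ S, a k * ∏ j, ⟪b (k j), z⟫ ∂κ := by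
    rw [integral_finsetSum _ fun k _ => (hint k).const_mul _]
    simp_rw [integral_const_mul]
    exact Finset.sum_congr rfl fun k _ => sq (a k)
  have h2 : A ≤ √A * M := by
    conv_lhs => rw [h1]
    rw [hM, ← integral_const_mul]
    refine integral_mono (integrable_finsetSum _ fun k _ => (hint k).const_mul _)
      (hκ.const_mul _) fun z => ?_
    refine (Real.sum_mul_le_sqrt_mul_sqrt _ _ _).trans ?_
    refine mul_le_mul_of_nonneg_left ?_ (Real.sqrt_nonneg _)
    rw [Real.sqrt_le_left (by positivity)]
    exact sum_prod_inner_sq_le b.orthonormal S z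
  have h3 : √A ≤ M := by
    by_contra! hlt
    have hpos : 0 < √A := hM0.trans_lt hlt
    nlinarith [Real.mul_self_sqrt hA0]
  calc A = √A ^ 2 := (Real.sq_sqrt hA0).symm
    _ ≤ M ^ 2 := pow_le_pow_left₀ (Real.sqrt_nonneg _) h3 2

lemma countable_of_orthonormal [SecondCountableTopology H] {ι : Type*} {b : ι → H}
    (hb : Orthonormal ℝ b) : Countable ι := by
  rw [← Set.countable_univ_iff]
  refine Set.PairwiseDisjoint.countable_of_isOpen (s := fun k => Metric.ball (b k) (1 / 2)) ?_
    (fun _ _ => Metric.isOpen_ball) (fun _ _ => Metric.nonempty_ball.2 (by norm_num))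
  intro k _ l _ hkl
  refine Metric.ball_disjoint_ball ?_
  have h1 : ‖b k - b l‖ ^ 2 = 2 := by
    rw [norm_sub_sq_real, hb.1, hb.1, hb.2 hkl]
    norm_num
  rw [dist_eq_norm]
  nlinarith [norm_nonneg (b k - b l)]

/-- The trace of the second moment of a measure is the integral of `|z|²`, by Parseval's
identity. -/
lemma hasTrace_integral_powForm [MeasurableSpace H] [BorelSpace H]
    [SecondCountableTopology H] {κ : Measure H}
    (hκ : Integrable (fun z => ‖z‖ ^ 2) κ) (c : ℝ) :
    HasTrace (c • ∫ z, powForm 2 z ∂κ) (c * ∫ z, ‖z‖ ^ 2 ∂κ) := by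
  intro ι b
  have := countable_of_orthonormal b.orthonormal
  have hterm : ∀ k, (c • ∫ z, powForm 2 z ∂κ) ![b k, b k] = c * ∫ z, ⟪b k, z⟫ ^ 2 ∂κ := by
    intro k
    rw [_root_.smul_apply, integral_powForm_apply hκ, smul_eq_mul]
    simp [Fin.prod_univ_two, sq]
  have hint : ∀ k, Integrable (fun z => ⟪b k, z⟫ ^ 2) κ := fun k => by
    simpa [Fin.prod_univ_two, sq] using integrable_prod_inner hκ ![b k, b k]
  simp_rw [hterm]
  refine HasSum.mul_left c ?_
  have h1 := hasSum_integral_of_summable_integral_norm hint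
    (summable_of_sum_le (c := ∫ z, ‖z‖ ^ 2 ∂κ) (fun k => integral_nonneg fun z => norm_nonneg _)
      fun S => ?_)
  · have h2 : ∀ z : H, ‖z‖ ^ 2 = ∑' k, ⟪b k, z⟫ ^ 2 := fun z => by
      rw [← real_inner_self_eq_norm_sq, ← (b.hasSum_inner_mul_inner z z).tsum_eq]
      refine tsum_congr fun k => ?_
      rw [real_inner_comm, sq]
    simp_rw [h2]
    exact h1
  · rw [← integral_finsetSum _ fun k _ => (hint k).norm]
    refine integral_mono (integrable_finsetSum _ fun k _ => (hint k).norm) hκ fun z => ?_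
    simpa using b.orthonormal.sum_inner_products_le z (s := S)

end TensorPower

/-! ### Gradients and conditional means -/

section Gradient

variable {W H : Type*} [NormedAddCommGroup W] [NormedSpace ℝ W] [MeasurableSpace W]
  [NormedAddCommGroup H] [InnerProductSpace ℝ H] {i : H →L[ℝ] W} {μ : Measure W} {F : W → ℝ}

lemma HasGradient.ae_unique [SecondCountableTopology H] {G G' : W → H}
    (h₁ : HasGradient i μ F G) (h₂ : HasGradient i μ F G') : G =ᵐ[μ] G' := by
  have h : ∀ n, ∀ᵐ v ∂μ, ⟪G v, TopologicalSpace.denseSeq H n⟫ =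
      ⟪G' v, TopologicalSpace.denseSeq H n⟫ := fun n =>
    (h₁.derivAlong _).ae_unique (h₂.derivAlong _)
  filter_upwards [ae_all_iff.2 h] with v hv
  refine ext_inner_right ℝ fun g => ?_
  have hd := TopologicalSpace.denseRange_denseSeq H
  exact congrFun (hd.equalizer (g := fun g => ⟪G v, g⟫) (h := fun g => ⟪G' v, g⟫)
    (by fun_prop) (by fun_prop) (funext hv)) g

variable [CompleteSpace H] [BorelSpace W] [CompleteSpace W] [SecondCountableTopology W]

lemma HasIteratedDerivAlong.congr_deriv (hμ : IsAbstractWienerSpace i μ) {n : ℕ} {h : Fin n → H}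
    {G G' : W → ℝ} (hF : HasIteratedDerivAlong i μ F n h G) (hG : G =ᵐ[μ] G') :
    HasIteratedDerivAlong i μ F n h G' := by
  cases n with
  | zero => exact hG.symm.trans hF
  | succ n =>
    obtain ⟨K, hK, hKG⟩ := hF
    exact ⟨K, hK, hKG.congr hμ EventuallyEq.rfl hG⟩

end Gradient

section Posterior

variable {W H : Type*} [NormedAddCommGroup W] [NormedSpace ℝ W] [CompleteSpace W]
  [SecondCountableTopology W] [MeasurableSpace W] [BorelSpace W]
  [NormedAddCommGroup H] [InnerProductSpace ℝ H] [CompleteSpace H]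
  [MeasurableSpace H] [BorelSpace H]
  {Ω : Type*} [MeasurableSpace Ω] {P : Measure Ω} [IsProbabilityMeasure P] {μ : Measure W}
  {x : Ω → H} {w : Ω → W} {i : H →L[ℝ] W} {Φ : H → StrongDual ℝ W} {ρ : ℝ}

/-- The law of the output has the same null sets as the noise. -/
lemma ae_of_ae_map_channel (hc : IsLiftedChannel i μ P x w Φ) {p : W → Prop}
    (hp : ∀ᵐ v ∂(P.map (channel i ρ x w)), p v) : ∀ᵐ v ∂μ, p v := by
  have : IsProbabilityMeasure (P.map x) :=
    Measure.isProbabilityMeasure_map hc.measurable_signal.aemeasurable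
  rw [map_channel_eq_withDensity hc,
    ae_withDensity_iff (measurable_totalLik hc.measurable_lift)] at hp
  filter_upwards [hp] with v hv
  exact hv (totalLik_pos hc.measurable_lift v).ne'

lemma likelihoodRatio_ae_eq_likMoment (hc : IsLiftedChannel i μ P x w Φ) :
    likelihoodRatio P (channel i ρ x w) μ =ᵐ[μ] likMoment ρ Φ (P.map x) 0 ![] := by
  filter_upwards [likelihoodRatio_ae_eq (ρ := ρ) hc] with v hv
  rw [hv, likMoment_zero hc.measurable_lift]

variable [SecondCountableTopology H]

lemma condMean_ae_eq (hc : IsLiftedChannel i μ P x w Φ) (n : ℕ) (h : Fin n → H) :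
    condMean P x (channel i ρ x w) (fun z => ∏ k, ⟪h k, z⟫) =ᵐ[μ]
      fun v => likMoment ρ Φ (P.map x) n h v / likMoment ρ Φ (P.map x) 0 ![] v := by
  have : IsProbabilityMeasure (P.map x) :=
    Measure.isProbabilityMeasure_map hc.measurable_signal.aemeasurable
  have hΦ := hc.measurable_lift
  filter_upwards [condDistrib_ae_eq (ρ := ρ) hc] with v hv
  have hd : Measurable fun z => (totalLik ρ Φ (P.map x) v)⁻¹ * ENNReal.ofReal (lik ρ Φ v z) :=
    (measurable_lik_right hΦ v).ennreal_ofReal.const_mul _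
  rw [condMean, hv, integral_withDensity_eq_integral_toReal_smul hd
    (ae_of_all _ fun z => ENNReal.mul_lt_top
      (ENNReal.inv_lt_top.2 (totalLik_pos hΦ v)) ENNReal.ofReal_lt_top),
    likMoment_zero hΦ, div_eq_inv_mul, likMoment, ← integral_const_mul]
  refine integral_congr_ae (ae_of_all _ fun z => ?_)
  simp only [ENNReal.toReal_mul, ENNReal.toReal_inv,
    ENNReal.toReal_ofReal (lik_pos ρ Φ v z).le, smul_eq_mul, mul_assoc]

/-- The posterior moments are finite even if the corresponding moment of the signal is infinite,
since the posterior has exponential moments. -/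
lemma ae_integrable_prod_condDistrib (hc : IsLiftedChannel i μ P x w Φ) (hρ : ρ ≠ 0) {n : ℕ}
    (h : Fin n → H) :
    ∀ᵐ v ∂μ, Integrable (fun z => ∏ k, ⟪h k, z⟫) (condDistrib x (channel i ρ x w) P v) := by
  have : IsProbabilityMeasure (P.map x) :=
    Measure.isProbabilityMeasure_map hc.measurable_signal.aemeasurable
  have hΦ := hc.measurable_lift
  filter_upwards [condDistrib_ae_eq (ρ := ρ) hc,
    ae_mem_expDomain hc hρ (Set.countable_range h)] with v hv hvD
  have hd : Measurable fun z => (totalLik ρ Φ (P.map x) v)⁻¹ * ENNReal.ofReal (lik ρ Φ v z) :=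
    (measurable_lik_right hΦ v).ennreal_ofReal.const_mul _
  rw [hv, integrable_withDensity_iff_integrable_smul' hd
    (ae_of_all _ fun z => ENNReal.mul_lt_top
      (ENNReal.inv_lt_top.2 (totalLik_pos hΦ v)) ENNReal.ofReal_lt_top)]
  refine ((integrable_lik_mul_prod hΦ hvD h fun k => ⟨k, rfl⟩).const_mul
    (totalLik ρ Φ (P.map x) v).toReal⁻¹).congr (ae_of_all _ fun z => ?_)
  simp only [ENNReal.toReal_mul, ENNReal.toReal_inv,
    ENNReal.toReal_ofReal (lik_pos ρ Φ v z).le, smul_eq_mul, mul_assoc]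

lemma ae_integrable_condDistrib (hc : IsLiftedChannel i μ P x w Φ) {E : Type*}
    [NormedAddCommGroup E] {f : H → E} (hf : StronglyMeasurable f)
    (hint : Integrable (fun ω => f (x ω)) P) :
    ∀ᵐ v ∂μ, Integrable f (condDistrib x (channel i ρ x w) P v) := by
  refine ae_of_ae_map_channel (ρ := ρ) hc ?_
  have hyx : Measurable fun ω => (channel i ρ x w ω, x ω) :=
    hc.measurable_channel.prodMk hc.measurable_signal
  have hf2 : StronglyMeasurable fun p : W × H => f p.2 := hf.comp_measurable measurable_snd
  exact Integrable.condDistrib_ae_map (f := fun p : W × H => f p.2)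
    hc.measurable_signal.aemeasurable
    ((integrable_map_measure hf2.aestronglyMeasurable hyx.aemeasurable).2 hint)

variable {ℓ : W → ℝ} {m : (n : ℕ) → (Fin n → H) → W → ℝ}

lemma hasIteratedDerivAlong_likelihood (hc : IsLiftedChannel i μ P x w Φ)
    (hℓ : ℓ =ᵐ[μ] likMoment ρ Φ (P.map x) 0 ![]) (n : ℕ) (h : Fin n → H) :
    HasIteratedDerivAlong i μ ℓ n h (fun v => ρ ^ n * likMoment ρ Φ (P.map x) n h v) := by
  induction n with
  | zero =>
    change (fun v => ρ ^ 0 * likMoment ρ Φ (P.map x) 0 h v) =ᵐ[μ] ℓ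
    filter_upwards [hℓ] with v hv
    rw [hv, pow_zero, one_mul, Subsingleton.elim h ![]]
  | succ n ih =>
    refine ⟨_, ih (Fin.init h), ?_⟩
    simpa only [pow_succ, mul_assoc] using hasDerivAlong_likMoment hc (ρ ^ n) h

end Posterior

end GaussianChannel

theorem proposition4p1
    {Ω W H : Type*}
    [NormedAddCommGroup W] [NormedSpace ℝ W] [CompleteSpace W] [SecondCountableTopology W]
    [MeasurableSpace W] [BorelSpace W]
    [NormedAddCommGroup H] [InnerProductSpace ℝ H] [CompleteSpace H] [SecondCountableTopology H]
    [MeasurableSpace H] [BorelSpace H]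
    (i : H →L[ℝ] W) (μ : Measure W) (hμ : GaussianChannel.IsAbstractWienerSpace i μ)
    [MeasurableSpace Ω] (P : Measure Ω) [IsProbabilityMeasure P]
    (x : Ω → H) (w : Ω → W) (hx : Measurable x) (hw : Measurable w)
    (hxw : IndepFun x w P) (hwlaw : P.map w = μ)
    -- the signal is `W*`-valued
    (hxdual : ∀ᵐ ω ∂P, x ω ∈ Set.range (GaussianChannel.dualEmb i))
    (hexp : ∀ (α : ℝ) (φ : StrongDual ℝ W),
      Integrable (fun ω => Real.exp (α * ⟪x ω, GaussianChannel.dualEmb i φ⟫)) P)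
    (ρ : ℝ) (y : Ω → W) (hy : y = GaussianChannel.channel i ρ x w)
    (ℓ : W → ℝ) (hℓ : ℓ = GaussianChannel.likelihoodRatio P y μ)
    -- `xbar = E(x | Y)`
    (xbar : W → H) (hxbar : xbar = GaussianChannel.condMean P x y id)
    -- `m n h = E(∏ (h_k, x) | Y)`
    (m : (n : ℕ) → (Fin n → H) → W → ℝ)
    (hm : ∀ n h, m n h = GaussianChannel.condMean P x y fun z => ∏ k, ⟪h k, z⟫) :
    -- the likelihood ratio is a positive density of the law of `y`
    (P.map y ≪ μ ∧ ∀ᵐ v ∂μ, 0 < ℓ v) ∧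
    -- the conditional moments are finite
    (ρ ≠ 0 → ∀ (n : ℕ) (h : Fin n → H), ∀ᵐ v ∂μ,
      Integrable (fun z => ∏ k, ⟪h k, z⟫) (condDistrib x y P v)) ∧
    -- (a), in a direction `h`
    (∀ h : H,
      GaussianChannel.HasDerivAlong i μ h ℓ (fun v => ρ * ℓ v * m 1 ![h] v) ∧
      GaussianChannel.HasDerivAlong i μ h (fun v => Real.log (ℓ v)) (fun v => ρ * m 1 ![h] v)) ∧
    -- (a), for the gradients
    (Integrable (fun ω => ‖x ω‖) P →
      (∀ᵐ v ∂μ, Integrable id (condDistrib x y P v)) ∧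
      (∀ h : H, ∀ᵐ v ∂μ, ⟪xbar v, h⟫ = m 1 ![h] v) ∧
      GaussianChannel.HasGradient i μ ℓ (fun v => (ρ * ℓ v) • xbar v) ∧
      GaussianChannel.HasGradient i μ (fun v => Real.log (ℓ v)) (fun v => ρ • xbar v) ∧
      (ρ ≠ 0 → ∀ G : W → H, GaussianChannel.HasGradient i μ (fun v => Real.log (ℓ v)) G →
        ∀ᵐ v ∂μ, xbar v = (1 / ρ) • G v)) ∧
    -- (b), in directions `h₁, …, hₙ`
    (∀ (n : ℕ) (h : Fin n → H),
      GaussianChannel.HasIteratedDerivAlong i μ ℓ n h (fun v => ρ ^ n * ℓ v * m n h v)) ∧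
    -- (b), for the `n`-th gradient
    (∀ n : ℕ, Integrable (fun ω => ‖x ω‖ ^ n) P →
      ∃ T : W → ContinuousMultilinearMap ℝ (fun _ : Fin n => H) ℝ,
        GaussianChannel.HasIteratedGradient i μ n ℓ T ∧
        ∀ᵐ v ∂μ, Integrable (fun z => ‖z‖ ^ n) (condDistrib x y P v) ∧
          ∀ h : Fin n → H, T v h = ρ ^ n * ℓ v * m n h v) ∧
    -- (c), existence of the trace of `∇²ℓ`
    (Integrable (fun ω => ‖x ω‖ ^ 2) P →
      ∃ T : W → ContinuousMultilinearMap ℝ (fun _ : Fin 2 => H) ℝ,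
        GaussianChannel.HasIteratedGradient i μ 2 ℓ T ∧
        ∀ᵐ v ∂μ, GaussianChannel.HasTrace (T v)
          (ρ ^ 2 * ℓ v * GaussianChannel.condMean P x y (fun z => ‖z‖ ^ 2) v)) ∧
    -- (c), `∇²_{h₁,h₂} φ = (∇ (∇ φ, h₂), h₁)` for `φ = ℓ`
    (∀ h₁ h₂ : H, GaussianChannel.HasIteratedDerivAlong i μ ℓ 2 ![h₂, h₁]
      (fun v => ρ ^ 2 * ℓ v * m 2 ![h₁, h₂] v)) ∧
    -- (c), `∇²_{h,h}` of `log ℓ`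
    (∀ h : H, GaussianChannel.HasIteratedDerivAlong i μ (fun v => Real.log (ℓ v)) 2 ![h, h]
      (fun v => ρ ^ 2 * (m 2 ![h, h] v - m 1 ![h] v ^ 2))) ∧
    -- (d), with `n + 1` factors
    (∀ (n : ℕ) (h : Fin (n + 1) → H),
      GaussianChannel.HasDerivAlong i μ (h (Fin.last n)) (m n (Fin.init h))
        (fun v => ρ * (m (n + 1) h v - m 1 ![h (Fin.last n)] v * m n (Fin.init h) v)) ∧
      (ρ ≠ 0 → ∀ D : W → ℝ,
        GaussianChannel.HasDerivAlong i μ (h (Fin.last n)) (m n (Fin.init h)) D →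
        ∀ᵐ v ∂μ, m (n + 1) h v =
          m 1 ![h (Fin.last n)] v * m n (Fin.init h) v + (1 / ρ) * D v)) := by
  obtain ⟨Φ, hΦ, hlift⟩ := GaussianChannel.exists_measurable_dual_lift hμ.denseRange (P.map x)
    ((ae_map_iff hx.aemeasurable (GaussianChannel.measurableSet_range_dualEmb hμ.injective)).2
      hxdual)
  have hc : GaussianChannel.IsLiftedChannel i μ P x w Φ := ⟨hμ, hx, hw, hxw, hwlaw, hΦ, hlift⟩
  have := hμ.isProbabilityMeasure
  have : IsProbabilityMeasure (P.map x) := Measure.isProbabilityMeasure_map hx.aemeasurable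
  have hℓm : Measurable ℓ := by
    rw [hℓ]
    exact (Measure.measurable_rnDeriv _ _).ennreal_toReal
  have hℓ0 : ℓ =ᵐ[μ] GaussianChannel.likMoment ρ Φ (P.map x) 0 ![] := by
    rw [hℓ, hy]
    exact GaussianChannel.likelihoodRatio_ae_eq_likMoment hc
  have hm0 : ∀ n h, m n h =ᵐ[μ] fun v => GaussianChannel.likMoment ρ Φ (P.map x) n h v /
      GaussianChannel.likMoment ρ Φ (P.map x) 0 ![] v := fun n h => by
    rw [hm, hy]
    exact GaussianChannel.condMean_ae_eq hc n h
  have hpos0 : ∀ᵐ v ∂μ, 0 < GaussianChannel.likMoment ρ Φ (P.map x) 0 ![] v := by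
    filter_upwards [GaussianChannel.ae_totalLik_lt_top (ρ := ρ) hc] with v hv
    exact GaussianChannel.likMoment_zero_pos hΦ ![]
      (GaussianChannel.integrable_lik_of_totalLik_lt_top hΦ hv)
  have hℓm0 : ∀ n h, ∀ᵐ v ∂μ, GaussianChannel.likMoment ρ Φ (P.map x) n h v = ℓ v * m n h v := by
    intro n h
    filter_upwards [hℓ0, hm0 n h, hpos0] with v h1 h2 h3
    rw [h1, h2, mul_div_cancel₀ _ h3.ne']
  have hiter : ∀ (n : ℕ) (h : Fin n → H),
      GaussianChannel.HasIteratedDerivAlong i μ ℓ n h (fun v => ρ ^ n * ℓ v * m n h v) := by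
    intro n h
    refine (GaussianChannel.hasIteratedDerivAlong_likelihood hc hℓ0 n h).congr_deriv hμ ?_
    filter_upwards [hℓm0 n h] with v hv
    rw [hv, mul_assoc]
  have hdir : ∀ h : H,
      GaussianChannel.HasDerivAlong i μ h ℓ (fun v => ρ * ℓ v * m 1 ![h] v) := by
    intro h
    have h1 := GaussianChannel.hasDerivAlong_likMoment (ρ := ρ) hc 1 ![h]
    refine h1.congr hμ ?_ ?_
    · filter_upwards [hℓ0] with v hv
      rw [hv, one_mul, Subsingleton.elim (Fin.init ![h]) ![]]
    · filter_upwards [hℓm0 1 ![h]] with v hv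
      rw [hv, one_mul, mul_assoc]
  have hdirlog : ∀ h : H, GaussianChannel.HasDerivAlong i μ h (fun v => Real.log (ℓ v))
      (fun v => ρ * m 1 ![h] v) := by
    intro h
    refine (GaussianChannel.hasDerivAlong_log_likMoment (ρ := ρ) hc h).congr hμ ?_ ?_
    · filter_upwards [hℓ0] with v hv
      rw [hv]
    · filter_upwards [hm0 1 ![h]] with v hv
      rw [hv]
  -- the quotient rule for the conditional moments
  have hmom : ∀ (c : ℝ) (n : ℕ) (h : Fin (n + 1) → H),
      GaussianChannel.HasDerivAlong i μ (h (Fin.last n)) (fun v => c * m n (Fin.init h) v)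
        (fun v => c * (ρ * (m (n + 1) h v - m 1 ![h (Fin.last n)] v * m n (Fin.init h) v))) := by
    intro c n h
    refine (GaussianChannel.hasDerivAlong_likMoment_div (ρ := ρ) hc c h).congr hμ ?_ ?_
    · filter_upwards [hm0 n (Fin.init h)] with v hv
      rw [hv]
    · filter_upwards [hm0 n (Fin.init h), hm0 (n + 1) h, hm0 1 ![h (Fin.last n)]] with v h1 h2 h3
      rw [h1, h2, h3]
  have hmom1 : ∀ (n : ℕ) (h : Fin (n + 1) → H),
      GaussianChannel.HasDerivAlong i μ (h (Fin.last n)) (m n (Fin.init h))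
        (fun v => ρ * (m (n + 1) h v - m 1 ![h (Fin.last n)] v * m n (Fin.init h) v)) := by
    intro n h
    simpa only [one_mul] using hmom 1 n h
  have hgrad : ∀ n : ℕ, Integrable (fun ω => ‖x ω‖ ^ n) P →
      GaussianChannel.HasIteratedGradient i μ n ℓ (fun v => (ρ ^ n * ℓ v) •
        ∫ z, GaussianChannel.powForm n z ∂(condDistrib x y P v)) ∧
      ∀ᵐ v ∂μ, Integrable (fun z => ‖z‖ ^ n) (condDistrib x y P v) ∧
        ∀ h : Fin n → H, ((ρ ^ n * ℓ v) •
          ∫ z, GaussianChannel.powForm n z ∂(condDistrib x y P v)) h = ρ ^ n * ℓ v * m n h v := by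
    intro n hn
    have hint : ∀ᵐ v ∂μ, Integrable (fun z => ‖z‖ ^ n) (condDistrib x y P v) := by
      rw [hy]
      exact GaussianChannel.ae_integrable_condDistrib hc
        (continuous_norm.pow n).stronglyMeasurable hn
    have happ : ∀ᵐ v ∂μ, ∀ h : Fin n → H, ((ρ ^ n * ℓ v) •
        ∫ z, GaussianChannel.powForm n z ∂(condDistrib x y P v)) h = ρ ^ n * ℓ v * m n h v := by
      filter_upwards [hint] with v hv h
      rw [_root_.smul_apply, GaussianChannel.integral_powForm_apply hv, smul_eq_mul, hm]
      rfl
    refine ⟨⟨?_, fun h => (hiter n h).congr_deriv hμ ?_⟩, hint.and happ⟩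
    · filter_upwards [hint] with v hv
      exact GaussianChannel.isHilbertSchmidt_integral_powForm hv _
    · filter_upwards [happ] with v hv
      exact (hv h).symm
  refine ⟨⟨?_, ?_⟩, ?_, fun h => ⟨hdir h, hdirlog h⟩, ?_, hiter, fun n hn => ⟨_, hgrad n hn⟩,
    ?_, ?_, ?_, fun n h => ⟨hmom1 n h, fun hρ D hD => ?_⟩⟩
  · rw [hy, GaussianChannel.map_channel_eq_withDensity hc]
    exact withDensity_absolutelyContinuous _ _
  · filter_upwards [hℓ0, hpos0] with v h1 h2
    rwa [h1]
  · rw [hy]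
    exact fun hρ n h => GaussianChannel.ae_integrable_prod_condDistrib hc hρ h
  · intro hx1
    have hint : ∀ᵐ v ∂μ, Integrable id (condDistrib x y P v) := by
      rw [hy]
      exact GaussianChannel.ae_integrable_condDistrib hc stronglyMeasurable_id
        ((integrable_norm_iff hx.aestronglyMeasurable).1 hx1)
    have hinner : ∀ h : H, ∀ᵐ v ∂μ, ⟪xbar v, h⟫ = m 1 ![h] v := by
      intro h
      filter_upwards [hint] with v hv
      rw [hxbar, hm, GaussianChannel.condMean, GaussianChannel.condMean, real_inner_comm,
        ← integral_inner hv]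
      simp
    have hxm : StronglyMeasurable xbar := by
      rw [hxbar]
      exact StronglyMeasurable.integral_condDistrib (f := fun p : W × H => p.2)
        measurable_snd.stronglyMeasurable
    have hlog : GaussianChannel.HasGradient i μ (fun v => Real.log (ℓ v))
        (fun v => ρ • xbar v) := by
      refine ⟨(hxm.const_smul ρ).aestronglyMeasurable,
        fun h => (hdirlog h).congr hμ EventuallyEq.rfl ?_⟩
      filter_upwards [hinner h] with v hv
      rw [real_inner_smul_left, hv]
    refine ⟨hint, hinner, ⟨?_, fun h => (hdir h).congr hμ EventuallyEq.rfl ?_⟩, hlog,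
      fun hρ G hG => ?_⟩
    · exact ((hℓm.const_mul ρ).stronglyMeasurable.smul hxm).aestronglyMeasurable
    · filter_upwards [hinner h] with v hv
      rw [real_inner_smul_left, hv]
    · filter_upwards [hG.ae_unique hlog] with v hv
      rw [hv, smul_smul, one_div_mul_cancel hρ, one_smul]
  · intro hx2
    refine ⟨_, (hgrad 2 hx2).1, ?_⟩
    filter_upwards [(hgrad 2 hx2).2] with v hv
    exact GaussianChannel.hasTrace_integral_powForm hv.1 _
  · intro h₁ h₂
    have h3 : m 2 ![h₁, h₂] = m 2 ![h₂, h₁] := by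
      rw [hm, hm]
      simp only [Fin.prod_univ_two, Matrix.cons_val_zero, Matrix.cons_val_one, mul_comm]
    rw [h3]
    exact hiter 2 ![h₂, h₁]
  · intro h
    refine ⟨fun v => ρ * m 1 ![h] v, ⟨fun v => Real.log (ℓ v), EventuallyEq.rfl, hdirlog h⟩, ?_⟩
    have hinit : Fin.init ![h, h] = ![h] := by
      funext k
      rw [Fin.fin_one_eq_zero k]
      rfl
    have h1 := hmom ρ 1 ![h, h]
    rw [hinit] at h1
    refine h1.congr hμ EventuallyEq.rfl (Eventually.of_forall fun v => ?_)
    change ρ * (ρ * (m 2 ![h, h] v - m 1 ![h] v * m 1 ![h] v)) = _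
    ring
  · filter_upwards [hD.ae_unique (hmom1 n h)] with v hv
    rw [hv]
    field_simp
    ring
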